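/- Let $n\ge 1$ be an integer. For $r\ge 1$ let $A_r(n)$ be the partition algebra over $\mathbb C$: it has as basis the set partitions (diagrams) of $\{1,\dots,r,1',\dots,r'\}$, and the product is $\rho_1\rho_2=n^{\ell}\,\rho_1\circ\rho_2$, where $\rho_1\circ\rho_2$ is obtained by placing $\rho_1$ above $\rho_2$, identifying the bottom row of $\rho_1$ with the top row of $\rho_2$ and deleting the $\ell$ components that lie entirely in the middle row. View $A_i(n)\subseteq A_r(n)$ for $i\le r$ by adding the blocks $\{j,j'\}$ for $i<j\le r$. Let $s_i$ be the diagram of the transposition $(i,i+1)$, let $p_i$ be the diagram with blocks $\{i\}$, $\{i'\}$ and $\{j,j'\}$ for $j\neq i$, and let $p_{i+\frac12}$ be the diagram with blocks $\{i,i+1,i',(i+1)'\}$ and $\{j,j'\}$ for $j\ne i,i+1$. **The elements $L$.** Put $L_0=0$, $L_1=p_1$, $\sigma_1=1$, $\sigma_2=s_1$ and, for $i\ge1$, $$L_{i+1}=-s_iL_ip_{i+\frac12}-p_{i+\frac12}L_is_i+p_{i+\frac12}L_ip_{i+1}p_{i+\frac12}+s_iL_is_i+\sigma_{i+1},$$ where,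 for $i\ge 2$, $$\begin{aligned}\sigma_{i+1}={}&s_{i-1}s_i\sigma_is_is_{i-1}+s_ip_{i-\frac12}L_{i-1}s_ip_{i-\frac12}s_i+p_{i-\frac12}L_{i-1}s_ip_{i-\frac12}\\&-s_ip_{i-\frac12}L_{i-1}s_{i-1}p_{i+\frac12}p_ip_{i-\frac12}-p_{i-\frac12}p_ip_{i+\frac12}s_{i-1}L_{i-1}p_{i-\frac12}s_i.\end{aligned}$$ Put $L_{\frac12}=0$, $\sigma_{\frac12}=\sigma_{1+\frac12}=1$ and, for $i\ge1$, $$L_{i+\frac12}=-L_ip_{i+\frac12}-p_{i+\frac12}L_i+p_{i+\frac12}L_ip_ip_{i+\frac12}+s_iL_{i-\frac12}s_i+\sigma_{i+\frac12},$$ where, for $i\ge2$, $$\begin{aligned}\sigma_{i+\frac12}={}&s_{i-1}s_i\sigma_{i-\frac12}s_is_{i-1}+p_{i-\frac12}L_{i-1}s_ip_{i-\frac12}s_i+s_ip_{i-\frac12}L_{i-1}s_ip_{i-\frac12}\\&-p_{i-\frac12}L_{i-1}s_{i-1}p_{i+\frac12}p_ip_{i-\frac12}-s_ip_{i-\frac12}p_ip_{i+\frac12}s_{i-1}L_{i-1}p_{i-\frac12}s_i.\end{aligned}$$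 **The Halverson–Ram elements $M$.** For a set $S$ of indices let $S'=\{\ell':\ell\in S\}$; for $I\subseteq S\cup S'$ let $I^c=(S\cup S')\setminus I$. Let $b_S$ be the diagram with blocks $S\cup S'$ and $\{\ell,\ell'\}$ for $\ell\notin S$, let $d_I$ be the diagram with blocks $I$, $I^c$ (when nonempty) and $\{\ell,\ell'\}$ for $\ell\notin S$, and let $$\varepsilon_I=(-1)^{\#\{\ell\in S:\{\ell,\ell'\}\subseteq I\}+\#\{\ell\in S:\{\ell,\ell'\}\subseteq I^c\}}.$$ Let $p_S=\sum_I\frac12\varepsilon_I d_I$, summed over all $I\subseteq S\cup S'$ with $I\neq\emptyset$, $I\ne S\cup S'$, and $I\neq\{\ell,\ell'\}$, $I\ne\{\ell,\ell'\}^c$ for every $\ell\in S$. For $k\ge1$ and $S\subseteq\{1,\dots,k+1\}$ with $k+1\in S$, let $\tilde p_S=\sum_I\frac12\varepsilon_Id_I$, summed over all $I\subseteq S\cup S'$ such that $\{k+1,(k+1)'\}\subseteq I$ or $\{k+1,(k+1)'\}\subseteq I^c$, with $I\ne\emptyset$, $I\neq S\cup S'$, and $I\ne\{\ell,\ell'\}$,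 $I\neq\{\ell,\ell'\}^c$ for every $\ell\in S\setminus\{k+1\}$. For $k\ge 1$ put $$Z_k=\binom k2+\sum_{\substack{S\subseteq\{1,\dots,k\}\\|S|\ge1}}p_S+\sum_{\substack{S\subseteq\{1,\dots,k\}\\|S|\ge2}}(n-k+|S|)(-1)^{|S|}b_S,$$ $$Z_{k+\frac12}=k+Z_k+\sum_{\substack{S\subseteq\{1,\dots,k+1\}\\k+1\in S,\ |S|\ge2}}\Big(\tilde p_S+(n-(k+1)+|S|)(-1)^{|S|}b_S\Big),$$ $$M_{k+\frac12}=Z_{k+\frac12}-Z_k,\qquad M_{k+1}=Z_{k+1}-Z_{k+\frac12}.$$ **Theorem.** For every $k\ge1$, $M_{k+\frac12}=L_{k+\frac12}$ and $M_{k+1}=L_{k+1}$ as elements of $A_{k+1}(n)$. -/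

import Mathlib

/-! ### Partition diagrams and their composition -/

/-- The vertices of a partition diagram on `r` strands.  `Sum.inl v` is the vertex with label
`v + 1` of the top row, `Sum.inr v` is the vertex with label `(v + 1)'` of the bottom row. -/
abbrev DiagVertex (r : ℕ) : Type := Fin r ⊕ Fin r

/-- The set of set partitions of `{1, …, r, 1', …, r'}`, a set partition being given by the
equivalence relation whose classes are its blocks. -/
abbrev PartDiagram (r : ℕ) : Type := Setoid (DiagVertex r)

/-- Place the two rows of a diagram in the rows `a` and `b` of an array with `m` rows. -/
def diagLayer {r m : ℕ} (a b : Fin m) : DiagVertex r → Fin m × Fin r :=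
  Sum.elim (fun v => (a, v)) (fun v => (b, v))

/-- The diagram with three rows (`0` the top one, `1` the middle one, `2` the bottom one) in which
`d` is placed above `e` and the bottom row of `d` is identified with the top row of `e`: the
equivalence relation generated by `d` on the rows `0, 1` and by `e` on the rows `1, 2`. -/
def diagStack {r : ℕ} (d e : PartDiagram r) : Setoid (Fin 3 × Fin r) :=
  Setoid.map d (diagLayer 0 1) ⊔ Setoid.map e (diagLayer 1 2)

/-- The composition `d ∘ e` (`d` above `e`): keep the top and the bottom row only. -/
def diagComp {r : ℕ} (d e : PartDiagram r) : PartDiagram r :=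
  Setoid.comap (diagLayer 0 2) (diagStack d e)

/-- The number of components of the stacked diagram that lie entirely in the middle row. -/
noncomputable def diagLoops {r : ℕ} (d e : PartDiagram r) : ℕ :=
  Nat.card {c : Quotient (diagStack d e) //
    ∀ v : DiagVertex r, Quotient.mk (diagStack d e) (diagLayer 0 2 v) ≠ c}

/-- The identity diagram, with blocks `{i, i'}`. -/
def diagId (r : ℕ) : PartDiagram r := Setoid.ker (Sum.elim id id)

/-! ### The composition of diagrams is associative and unital -/

theorem setoid_map_le_iff {α β : Type*} {s : Setoid α} {f : α → β} {t : Setoid β} :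
    s.map f ≤ t ↔ s ≤ t.comap f := by
  constructor
  · intro h x y hxy
    exact h (Setoid.le_comap_map hxy)
  · intro h
    refine Setoid.eqvGen_le ?_
    rintro _ _ ⟨x, y, hxy, rfl, rfl⟩
    exact h hxy

/-- Gluing two equivalence relations along a common part. -/
theorem exists_glue_equiv {V Y Y' X : Type*} (E : Setoid Y) (G : Setoid Y')
    (o : V → Y) (q : V → Y') (i : Y → X) (j : Y' → X)
    (hcomm : ∀ v, i (o v) = j (q v)) (hcov : ∀ x, (∃ a, x = j a) ∨ ∃ y, x = i y)
    (hij : ∀ y a, i y = j a → ∃ v, y = o v ∧ a = q v)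
    (hi : Function.Injective i) (hj : Function.Injective j) :
    ∃ e : Quotient (E.map i ⊔ G.map j) ≃
        Quotient ((E.comap o).map q ⊔ G) ⊕ {c : Quotient E // ∀ v, Quotient.mk E (o v) ≠ c},
      ∀ a, e (Quotient.mk _ (j a)) = Sum.inl (Quotient.mk _ a) := by
  classical
  set E' := (E.comap o).map q ⊔ G with hE'
  set F := E.map i ⊔ G.map j with hF
  have hEF : E ≤ F.comap i := setoid_map_le_iff.1 le_sup_left
  have hGF : G ≤ F.comap j := setoid_map_le_iff.1 le_sup_right
  have hoE' : E.comap o ≤ E'.comap q := setoid_map_le_iff.1 le_sup_left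
  have hE'F : E' ≤ F.comap j := by
    refine sup_le (setoid_map_le_iff.2 ?_) hGF
    intro v w hvw
    change F (j (q v)) (j (q w))
    rw [← hcomm, ← hcomm]
    exact hEF hvw
  have key : ∀ x, ∃ t : Quotient E' ⊕ {c : Quotient E // ∀ v, Quotient.mk E (o v) ≠ c},
      (∀ a, x = j a → t = Sum.inl (Quotient.mk _ a)) ∧
      (∀ y v, x = i y → E y (o v) → t = Sum.inl (Quotient.mk _ (q v))) ∧
      (∀ y (h : ∀ v, Quotient.mk E (o v) ≠ Quotient.mk E y), x = i y →
        t = Sum.inr ⟨Quotient.mk E y, h⟩) := by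
    intro x
    by_cases hx : ∃ a, x = j a
    · obtain ⟨a, rfl⟩ := hx
      refine ⟨Sum.inl (Quotient.mk _ a), ?_, ?_, ?_⟩
      · intro b hb
        rw [hj hb]
      · intro y v hy hyv
        obtain ⟨w, rfl, rfl⟩ := hij y a hy.symm
        exact congrArg _ (Quotient.sound (hoE' hyv))
      · intro y h hy
        obtain ⟨w, rfl, rfl⟩ := hij y a hy.symm
        exact absurd rfl (h w)
    · obtain ⟨y, rfl⟩ := (hcov x).resolve_left hx
      by_cases hy : ∃ v, E y (o v)
      · obtain ⟨v, hv⟩ := hy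
        refine ⟨Sum.inl (Quotient.mk _ (q v)), fun a ha => absurd ⟨a, ha⟩ hx, ?_, ?_⟩
        · intro z w hz hzw
          obtain rfl := hi hz
          exact congrArg _ (Quotient.sound (hoE' (E.trans' (E.symm' hv) hzw)))
        · intro z h hz
          obtain rfl := hi hz
          exact absurd (Quotient.sound (E.symm' hv)) (h v)
      · refine ⟨Sum.inr ⟨Quotient.mk E y, fun v h => hy ⟨v, E.symm' (Quotient.exact h)⟩⟩,
          fun a ha => absurd ⟨a, ha⟩ hx, ?_, ?_⟩
        · intro z w hz hzw
          obtain rfl := hi hz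
          exact absurd ⟨w, hzw⟩ hy
        · intro z h hz
          obtain rfl := hi hz
          rfl
  choose c hcj hco hcn using key
  have hFc : F ≤ Setoid.ker c := by
    refine sup_le (setoid_map_le_iff.2 ?_) (setoid_map_le_iff.2 ?_)
    · intro y z hyz
      change c (i y) = c (i z)
      by_cases hy : ∃ v, E y (o v)
      · obtain ⟨v, hv⟩ := hy
        rw [hco _ y v rfl hv, hco _ z v rfl (E.trans' (E.symm' hyz) hv)]
      · have h1 : ∀ v, Quotient.mk E (o v) ≠ Quotient.mk E y :=
          fun v h => hy ⟨v, E.symm' (Quotient.exact h)⟩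
        have h2 : ∀ v, Quotient.mk E (o v) ≠ Quotient.mk E z :=
          fun v h => hy ⟨v, E.trans' hyz (E.symm' (Quotient.exact h))⟩
        rw [hcn _ y h1 rfl, hcn _ z h2 rfl]
        exact congrArg _ (Subtype.ext (Quotient.sound hyz))
    · intro a b hab
      change c (j a) = c (j b)
      rw [hcj _ a rfl, hcj _ b rfl]
      exact congrArg _ (Quotient.sound ((le_sup_right : G ≤ E') hab))
  refine ⟨{ toFun := Quotient.lift c (fun x y h => hFc h)
            invFun := Sum.elim
              (Quotient.lift (fun a => Quotient.mk F (j a)) (fun a b h => Quotient.sound (hE'F h)))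
              (fun p => Quotient.lift (fun y => Quotient.mk F (i y))
                (fun a b h => Quotient.sound (hEF h)) p.1)
            left_inv := ?_
            right_inv := ?_ }, fun a => hcj _ a rfl⟩
  · intro x
    induction x using Quotient.ind with
    | _ x =>
    change Sum.elim _ _ (c x) = _
    rcases hcov x with ⟨a, rfl⟩ | ⟨y, rfl⟩
    · rw [hcj _ a rfl]
      rfl
    · by_cases hy : ∃ v, E y (o v)
      · obtain ⟨v, hv⟩ := hy
        rw [hco _ y v rfl hv]
        change Quotient.mk F (j (q v)) = _
        rw [← hcomm]
        exact Quotient.sound (hEF (E.symm' hv))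
      · have h1 : ∀ v, Quotient.mk E (o v) ≠ Quotient.mk E y :=
          fun v h => hy ⟨v, E.symm' (Quotient.exact h)⟩
        rw [hcn _ y h1 rfl]
        rfl
  · rintro (a | ⟨y, hy⟩)
    · induction a using Quotient.ind with
      | _ a => exact hcj _ a rfl
    · induction y using Quotient.ind with
      | _ y => exact hcn _ y hy rfl

theorem glue_comap {V Y Y' X : Type*} (E : Setoid Y) (G : Setoid Y')
    (o : V → Y) (q : V → Y') (i : Y → X) (j : Y' → X)
    (hcomm : ∀ v, i (o v) = j (q v)) (hcov : ∀ x, (∃ a, x = j a) ∨ ∃ y, x = i y)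
    (hij : ∀ y a, i y = j a → ∃ v, y = o v ∧ a = q v)
    (hi : Function.Injective i) (hj : Function.Injective j) :
    (E.map i ⊔ G.map j).comap j = (E.comap o).map q ⊔ G := by
  obtain ⟨e, he⟩ := exists_glue_equiv E G o q i j hcomm hcov hij hi hj
  ext a b
  rw [Setoid.comap_rel]
  constructor
  · intro h
    have h1 := congrArg e (Quotient.sound h)
    rw [he, he] at h1
    exact Quotient.exact (Sum.inl.inj h1)
  · intro h
    refine Quotient.exact (e.injective ?_)
    rw [he, he]
    exact congrArg _ (Quotient.sound h)

theorem glue_card {V W Y Y' X : Type*} [Finite Y] [Finite Y'] (E : Setoid Y) (G : Setoid Y')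
    (o : V → Y) (q : V → Y') (i : Y → X) (j : Y' → X)
    (hcomm : ∀ v, i (o v) = j (q v)) (hcov : ∀ x, (∃ a, x = j a) ∨ ∃ y, x = i y)
    (hij : ∀ y a, i y = j a → ∃ v, y = o v ∧ a = q v)
    (hi : Function.Injective i) (hj : Function.Injective j) (w : W → Y') :
    Nat.card {c : Quotient (E.map i ⊔ G.map j) // ∀ v, Quotient.mk _ (j (w v)) ≠ c} =
      Nat.card {c : Quotient E // ∀ v, Quotient.mk E (o v) ≠ c} +
      Nat.card {c : Quotient ((E.comap o).map q ⊔ G) // ∀ v, Quotient.mk _ (w v) ≠ c} := by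
  obtain ⟨e, he⟩ := exists_glue_equiv E G o q i j hcomm hcov hij hi hj
  rw [add_comm, ← Nat.card_sum]
  refine Nat.card_congr ?_
  refine (e.subtypeEquiv (q := fun t => ∀ v, Sum.inl (Quotient.mk _ (w v)) ≠ t) ?_).trans ?_
  · intro x
    refine forall_congr' fun v => not_congr ?_
    rw [← he, e.apply_eq_iff_eq]
  · refine (Equiv.subtypeSum).trans (Equiv.sumCongr ?_ ?_)
    · exact Equiv.subtypeEquivRight fun x => by simp
    · exact Equiv.subtypeUnivEquiv fun x => by simp

/-- Rename the rows of an array. -/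
def diagRows {r m m' : ℕ} (f : Fin m → Fin m') : Fin m × Fin r → Fin m' × Fin r :=
  fun x => (f x.1, x.2)

theorem diagRows_layer {r m m' : ℕ} (f : Fin m → Fin m') (a b : Fin m) (v : DiagVertex r) :
    diagRows f (diagLayer a b v) = diagLayer (f a) (f b) v := by
  cases v <;> rfl

theorem map_layer_rows {r m m' : ℕ} (d : PartDiagram r) (f : Fin m → Fin m') (a b : Fin m) :
    Setoid.map (Setoid.map d (diagLayer a b)) (diagRows f) =
      Setoid.map d (diagLayer (f a) (f b)) := by
  refine eq_of_forall_ge_iff fun t => ?_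
  rw [setoid_map_le_iff, setoid_map_le_iff, setoid_map_le_iff, ← Setoid.comap_comp]
  have : diagRows f ∘ diagLayer a b = diagLayer (r := r) (f a) (f b) :=
    funext fun v => diagRows_layer f a b v
  rw [this]

theorem map_sup_setoid {α β : Type*} (s t : Setoid α) (f : α → β) :
    (s ⊔ t).map f = s.map f ⊔ t.map f := by
  refine eq_of_forall_ge_iff fun u => ?_
  rw [setoid_map_le_iff, sup_le_iff, sup_le_iff, setoid_map_le_iff, setoid_map_le_iff]

/-- Three diagrams stacked in an array with four rows. -/
def diagStack3 {r : ℕ} (d e f : PartDiagram r) : Setoid (Fin 4 × Fin r) :=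
  Setoid.map d (diagLayer 0 1) ⊔ Setoid.map e (diagLayer 1 2) ⊔ Setoid.map f (diagLayer 2 3)

theorem diagRows_injective {r m m' : ℕ} {f : Fin m → Fin m'} (hf : Function.Injective f) :
    Function.Injective (diagRows (r := r) f) := by
  rintro ⟨a, v⟩ ⟨b, w⟩ h
  simp only [diagRows, Prod.mk.injEq] at h
  rw [hf h.1, h.2]

theorem stack3_left {r : ℕ} (d e f : PartDiagram r) :
    diagComp (diagComp d e) f = Setoid.comap (diagLayer 0 3) (diagStack3 d e f) ∧
    diagLoops d e + diagLoops (diagComp d e) f =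
      Nat.card {c : Quotient (diagStack3 d e f) //
        ∀ v : DiagVertex r, Quotient.mk _ (diagLayer 0 3 v) ≠ c} := by
  have h1 : diagStack3 d e f = (diagStack d e).map (diagRows ![0, 1, 2]) ⊔
      (Setoid.map f (diagLayer 1 2)).map (diagRows ![0, 2, 3]) := by
    rw [diagStack, map_sup_setoid, map_layer_rows, map_layer_rows, map_layer_rows]
    rfl
  have hcomm : ∀ v : DiagVertex r, diagRows (![0, 1, 2] : Fin 3 → Fin 4) (diagLayer 0 2 v) =
      diagRows (![0, 2, 3] : Fin 3 → Fin 4) (diagLayer 0 1 v) := by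
    intro v
    rw [diagRows_layer, diagRows_layer]
    rfl
  have hcov : ∀ x : Fin 4 × Fin r, (∃ a, x = diagRows ![0, 2, 3] a) ∨
      ∃ y, x = diagRows ![0, 1, 2] y := by
    rintro ⟨a, v⟩
    fin_cases a
    · exact Or.inl ⟨(0, v), rfl⟩
    · exact Or.inr ⟨(1, v), rfl⟩
    · exact Or.inl ⟨(1, v), rfl⟩
    · exact Or.inl ⟨(2, v), rfl⟩
  have hij : ∀ (y a : Fin 3 × Fin r),
      diagRows (![0, 1, 2] : Fin 3 → Fin 4) y = diagRows ![0, 2, 3] a →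
      ∃ v : DiagVertex r, y = diagLayer 0 2 v ∧ a = diagLayer 0 1 v := by
    rintro ⟨a, v⟩ ⟨b, w⟩ h
    simp only [diagRows, Prod.mk.injEq] at h
    obtain ⟨hab, rfl⟩ := h
    fin_cases a <;> fin_cases b <;> first
      | exact absurd hab (by decide)
      | exact ⟨Sum.inl v, rfl, rfl⟩
      | exact ⟨Sum.inr v, rfl, rfl⟩
  have hi : Function.Injective (diagRows (r := r) (![0, 1, 2] : Fin 3 → Fin 4)) :=
    diagRows_injective (by decide)
  have hj : Function.Injective (diagRows (r := r) (![0, 2, 3] : Fin 3 → Fin 4)) :=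
    diagRows_injective (by decide)
  have ho : (diagLayer 0 3 : DiagVertex r → Fin 4 × Fin r) =
      diagRows ![0, 2, 3] ∘ diagLayer 0 2 := by
    funext v
    exact (diagRows_layer (![0, 2, 3] : Fin 3 → Fin 4) 0 2 v).symm
  constructor
  · rw [h1, ho, Setoid.comap_comp, glue_comap _ _ _ _ _ _ hcomm hcov hij hi hj]
    rfl
  · rw [h1, ho]
    exact (glue_card _ _ _ _ _ _ hcomm hcov hij hi hj (diagLayer 0 2)).symm

theorem stack3_right {r : ℕ} (d e f : PartDiagram r) :
    diagComp d (diagComp e f) = Setoid.comap (diagLayer 0 3) (diagStack3 d e f) ∧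
    diagLoops e f + diagLoops d (diagComp e f) =
      Nat.card {c : Quotient (diagStack3 d e f) //
        ∀ v : DiagVertex r, Quotient.mk _ (diagLayer 0 3 v) ≠ c} := by
  have h1 : diagStack3 d e f = (diagStack e f).map (diagRows ![1, 2, 3]) ⊔
      (Setoid.map d (diagLayer 0 1)).map (diagRows ![0, 1, 3]) := by
    rw [diagStack, map_sup_setoid, map_layer_rows, map_layer_rows, map_layer_rows, sup_comm,
      ← sup_assoc]
    rfl
  have hcomm : ∀ v : DiagVertex r, diagRows (![1, 2, 3] : Fin 3 → Fin 4) (diagLayer 0 2 v) =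
      diagRows (![0, 1, 3] : Fin 3 → Fin 4) (diagLayer 1 2 v) := by
    intro v
    rw [diagRows_layer, diagRows_layer]
    rfl
  have hcov : ∀ x : Fin 4 × Fin r, (∃ a, x = diagRows ![0, 1, 3] a) ∨
      ∃ y, x = diagRows ![1, 2, 3] y := by
    rintro ⟨a, v⟩
    fin_cases a
    · exact Or.inl ⟨(0, v), rfl⟩
    · exact Or.inl ⟨(1, v), rfl⟩
    · exact Or.inr ⟨(1, v), rfl⟩
    · exact Or.inl ⟨(2, v), rfl⟩
  have hij : ∀ (y a : Fin 3 × Fin r),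
      diagRows (![1, 2, 3] : Fin 3 → Fin 4) y = diagRows ![0, 1, 3] a →
      ∃ v : DiagVertex r, y = diagLayer 0 2 v ∧ a = diagLayer 1 2 v := by
    rintro ⟨a, v⟩ ⟨b, w⟩ h
    simp only [diagRows, Prod.mk.injEq] at h
    obtain ⟨hab, rfl⟩ := h
    fin_cases a <;> fin_cases b <;> first
      | exact absurd hab (by decide)
      | exact ⟨Sum.inl v, rfl, rfl⟩
      | exact ⟨Sum.inr v, rfl, rfl⟩
  have hi : Function.Injective (diagRows (r := r) (![1, 2, 3] : Fin 3 → Fin 4)) :=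
    diagRows_injective (by decide)
  have hj : Function.Injective (diagRows (r := r) (![0, 1, 3] : Fin 3 → Fin 4)) :=
    diagRows_injective (by decide)
  have ho : (diagLayer 0 3 : DiagVertex r → Fin 4 × Fin r) =
      diagRows ![0, 1, 3] ∘ diagLayer 0 2 := by
    funext v
    exact (diagRows_layer (![0, 1, 3] : Fin 3 → Fin 4) 0 2 v).symm
  have h2 : diagStack d (diagComp e f) =
      (Setoid.comap (diagLayer 0 2) (diagStack e f)).map (diagLayer 1 2) ⊔
        Setoid.map d (diagLayer 0 1) := sup_comm _ _
  constructor
  · rw [h1, ho, Setoid.comap_comp, glue_comap _ _ _ _ _ _ hcomm hcov hij hi hj, ← h2]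
    rfl
  · rw [h1, ho, diagLoops, diagLoops, h2]
    exact (glue_card _ _ _ _ _ _ hcomm hcov hij hi hj (diagLayer 0 2)).symm

theorem diagComp_assoc {r : ℕ} (d e f : PartDiagram r) :
    diagComp (diagComp d e) f = diagComp d (diagComp e f) :=
  (stack3_left d e f).1.trans (stack3_right d e f).1.symm

theorem diagLoops_assoc {r : ℕ} (d e f : PartDiagram r) :
    diagLoops d e + diagLoops (diagComp d e) f = diagLoops e f + diagLoops d (diagComp e f) :=
  (stack3_left d e f).2.trans (stack3_right d e f).2.symm

theorem stack_id_left {r : ℕ} (d : PartDiagram r) :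
    diagStack (diagId r) d = Setoid.ker (fun x : Fin 3 × Fin r =>
      Quotient.mk d (if x.1 = 2 then Sum.inr x.2 else Sum.inl x.2)) := by
  apply le_antisymm
  · refine sup_le (setoid_map_le_iff.2 ?_) (setoid_map_le_iff.2 ?_)
    · rintro (v | v) (w | w) h <;> (obtain rfl : v = w := h) <;> rfl
    · rintro (v | v) (w | w) h <;> exact Quotient.sound h
  · have hl : diagId r ≤ (diagStack (diagId r) d).comap (diagLayer 0 1) :=
      setoid_map_le_iff.1 le_sup_left
    have hr : d ≤ (diagStack (diagId r) d).comap (diagLayer 1 2) :=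
      setoid_map_le_iff.1 le_sup_right
    have h0 : ∀ v : Fin r, diagStack (diagId r) d (0, v) (1, v) := fun v =>
      hl (x := Sum.inl v) (y := Sum.inr v) rfl
    have h1 : ∀ x : Fin 3 × Fin r, diagStack (diagId r) d x
        (diagLayer 1 2 (if x.1 = 2 then Sum.inr x.2 else Sum.inl x.2)) := by
      rintro ⟨a, v⟩
      fin_cases a
      · exact h0 v
      · exact Setoid.refl' _ _
      · exact Setoid.refl' _ _
    intro x y h
    exact Setoid.trans' _ (h1 x) (Setoid.trans' _ (hr (Quotient.exact h)) (Setoid.symm' _ (h1 y)))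

theorem stack_id_right {r : ℕ} (d : PartDiagram r) :
    diagStack d (diagId r) = Setoid.ker (fun x : Fin 3 × Fin r =>
      Quotient.mk d (if x.1 = 0 then Sum.inl x.2 else Sum.inr x.2)) := by
  apply le_antisymm
  · refine sup_le (setoid_map_le_iff.2 ?_) (setoid_map_le_iff.2 ?_)
    · rintro (v | v) (w | w) h <;> exact Quotient.sound h
    · rintro (v | v) (w | w) h <;> (obtain rfl : v = w := h) <;> rfl
  · have hl : diagId r ≤ (diagStack d (diagId r)).comap (diagLayer 1 2) :=
      setoid_map_le_iff.1 le_sup_right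
    have hr : d ≤ (diagStack d (diagId r)).comap (diagLayer 0 1) :=
      setoid_map_le_iff.1 le_sup_left
    have h0 : ∀ v : Fin r, diagStack d (diagId r) (2, v) (1, v) := fun v =>
      hl (x := Sum.inr v) (y := Sum.inl v) rfl
    have h1 : ∀ x : Fin 3 × Fin r, diagStack d (diagId r) x
        (diagLayer 0 1 (if x.1 = 0 then Sum.inl x.2 else Sum.inr x.2)) := by
      rintro ⟨a, v⟩
      fin_cases a
      · exact Setoid.refl' _ _
      · exact Setoid.refl' _ _
      · exact h0 v
    intro x y h
    exact Setoid.trans' _ (h1 x) (Setoid.trans' _ (hr (Quotient.exact h)) (Setoid.symm' _ (h1 y)))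

theorem diagComp_id_left {r : ℕ} (d : PartDiagram r) : diagComp (diagId r) d = d := by
  ext v w
  rw [diagComp, stack_id_left]
  rcases v with v | v <;> rcases w with w | w <;> exact Quotient.eq (r := d)

theorem diagComp_id_right {r : ℕ} (d : PartDiagram r) : diagComp d (diagId r) = d := by
  ext v w
  rw [diagComp, stack_id_right]
  rcases v with v | v <;> rcases w with w | w <;> exact Quotient.eq (r := d)

theorem diagLoops_id_left {r : ℕ} (d : PartDiagram r) : diagLoops (diagId r) d = 0 := by
  have : IsEmpty {c : Quotient (diagStack (diagId r) d) //
      ∀ v : DiagVertex r, Quotient.mk (diagStack (diagId r) d) (diagLayer 0 2 v) ≠ c} := by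
    refine ⟨fun ⟨c, hc⟩ => ?_⟩
    induction c using Quotient.ind with
    | _ x =>
    obtain ⟨a, v⟩ := x
    fin_cases a
    · exact hc (Sum.inl v) rfl
    · refine hc (Sum.inl v) (Quotient.sound ?_)
      change diagStack (diagId r) d _ _
      rw [stack_id_left]
      rfl
    · exact hc (Sum.inr v) rfl
  exact Nat.card_of_isEmpty

theorem diagLoops_id_right {r : ℕ} (d : PartDiagram r) : diagLoops d (diagId r) = 0 := by
  have : IsEmpty {c : Quotient (diagStack d (diagId r)) //
      ∀ v : DiagVertex r, Quotient.mk (diagStack d (diagId r)) (diagLayer 0 2 v) ≠ c} := by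
    refine ⟨fun ⟨c, hc⟩ => ?_⟩
    induction c using Quotient.ind with
    | _ x =>
    obtain ⟨a, v⟩ := x
    fin_cases a
    · exact hc (Sum.inl v) rfl
    · refine hc (Sum.inr v) (Quotient.sound ?_)
      change diagStack d (diagId r) _ _
      rw [stack_id_right]
      rfl
    · exact hc (Sum.inr v) rfl
  exact Nat.card_of_isEmpty

/-! ### The partition algebra -/

/-- The partition algebra on `r` strands with parameter `δ`: the free `R`-module on the set of
partition diagrams, with the product `d * e = δ ^ ℓ • (d ∘ e)`, where `ℓ` is the number of
components removed from the middle row. -/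
def PartAlg (R : Type*) [CommRing R] (_δ : R) (r : ℕ) : Type _ := PartDiagram r →₀ R

namespace PartAlg

noncomputable section

variable {R : Type*} [CommRing R] {δ : R} {r : ℕ}

instance : AddCommGroup (PartAlg R δ r) := inferInstanceAs (AddCommGroup (PartDiagram r →₀ R))

instance : Module R (PartAlg R δ r) := inferInstanceAs (Module R (PartDiagram r →₀ R))

/-- The diagram basis. -/
def diagBasis : Module.Basis (PartDiagram r) R (PartAlg R δ r) :=
  .ofRepr (LinearEquiv.refl R (PartDiagram r →₀ R))

/-- The basis element of the partition algebra given by a diagram. -/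
def diag (d : PartDiagram r) : PartAlg R δ r := diagBasis d

/-- The product of the partition algebra as a bilinear map. -/
def mulMap : PartAlg R δ r →ₗ[R] PartAlg R δ r →ₗ[R] PartAlg R δ r :=
  diagBasis.constr R fun d => diagBasis.constr R fun e =>
    δ ^ diagLoops d e • diag (diagComp d e)

instance : Mul (PartAlg R δ r) := ⟨fun a b => mulMap a b⟩

instance : One (PartAlg R δ r) := ⟨diag (diagId r)⟩

theorem diag_mul_diag (d e : PartDiagram r) :
    (diag d * diag e : PartAlg R δ r) = δ ^ diagLoops d e • diag (diagComp d e) := by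
  change mulMap (diagBasis d) (diagBasis e) = _
  rw [mulMap, Module.Basis.constr_basis, Module.Basis.constr_basis]

theorem induction_diag {p : PartAlg R δ r → Prop} (h0 : p 0) (hadd : ∀ a b, p a → p b → p (a + b))
    (hs : ∀ (x : R) d, p (x • diag d)) (a : PartAlg R δ r) : p a := by
  rw [← diagBasis.linearCombination_repr a, Finsupp.linearCombination_apply, Finsupp.sum]
  exact Finset.sum_induction _ p hadd h0 fun d _ => hs _ d

instance : NonUnitalNonAssocRing (PartAlg R δ r) where
  left_distrib a b c := map_add (mulMap a) b c
  right_distrib a b c := LinearMap.map_add₂ mulMap a b c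
  zero_mul a := LinearMap.map_zero₂ mulMap a
  mul_zero a := map_zero (mulMap a)

instance : IsScalarTower R (PartAlg R δ r) (PartAlg R δ r) :=
  ⟨fun x a b => LinearMap.map_smul₂ mulMap x a b⟩

instance : SMulCommClass R (PartAlg R δ r) (PartAlg R δ r) :=
  ⟨fun x a b => (map_smul (mulMap a) x b).symm⟩

instance : Ring (PartAlg R δ r) where
  __ := (inferInstance : NonUnitalNonAssocRing (PartAlg R δ r))
  mul_assoc a b c := by
    induction a using induction_diag with
    | h0 => simp only [zero_mul]
    | hadd a a' h h' => simp only [add_mul, h, h']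
    | hs x d =>
    induction b using induction_diag with
    | h0 => simp only [zero_mul, mul_zero]
    | hadd b b' h h' => simp only [add_mul, mul_add, h, h']
    | hs y e =>
    induction c using induction_diag with
    | h0 => simp only [mul_zero]
    | hadd c c' h h' => simp only [mul_add, h, h']
    | hs z f =>
    simp only [smul_mul_assoc, mul_smul_comm, diag_mul_diag, diagComp_assoc, smul_smul]
    congr 1
    have h := congrArg (δ ^ ·) (diagLoops_assoc d e f)
    simp only [pow_add] at h
    linear_combination x * y * z * h
  one_mul a := by
    induction a using induction_diag with
    | h0 => rw [mul_zero]
    | hadd a b h h' => rw [mul_add, h, h']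
    | hs x d =>
    change diag (diagId r) * (x • diag d) = _
    rw [mul_smul_comm, diag_mul_diag, diagLoops_id_left, diagComp_id_left, pow_zero, one_smul]
  mul_one a := by
    induction a using induction_diag with
    | h0 => rw [zero_mul]
    | hadd a b h h' => rw [add_mul, h, h']
    | hs x d =>
    change (x • diag d) * diag (diagId r) = _
    rw [smul_mul_assoc, diag_mul_diag, diagLoops_id_right, diagComp_id_right, pow_zero, one_smul]

instance : Algebra R (PartAlg R δ r) :=
  Algebra.ofModule (fun x a b => smul_mul_assoc x a b) (fun x a b => mul_smul_comm x a b)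

/-! ### Generators and the recursively defined elements

All elements are taken in the algebra on `r` strands; the elements with index `i ≤ r` of a smaller
algebra are included by adding vertical strands on the right.  Generators with indices outside the
ranges indicated below are irrelevant. -/

variable (R δ r)

/-- The generator `s_i`, for `1 ≤ i` and `i + 1 ≤ r`: the diagram of the transposition
`(i, i + 1)`. -/
def s (i : ℕ) : PartAlg R δ r :=
  diag (Setoid.ker (Sum.elim (fun v : Fin r => (v : ℕ) + 1)
    (fun v : Fin r => Equiv.swap i (i + 1) ((v : ℕ) + 1))))

/-- The generator `p_i`, for `1 ≤ i ≤ r`: the blocks are `{i}`, `{i'}` and `{j, j'}` for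
`j ≠ i`. -/
def p (i : ℕ) : PartAlg R δ r :=
  diag (Setoid.ker (Sum.elim (fun v : Fin r => ((v : ℕ) + 1, False))
    (fun v : Fin r => ((v : ℕ) + 1, (v : ℕ) + 1 = i))))

/-- The generator `p_{i + 1/2}`, for `1 ≤ i` and `i + 1 ≤ r`: the blocks are
`{i, i + 1, i', (i + 1)'}` and `{j, j'}` for `j ≠ i, i + 1`. -/
def pHalf (i : ℕ) : PartAlg R δ r :=
  diag (Setoid.ker (Sum.elim
    (fun v : Fin r => if (v : ℕ) + 1 = i + 1 then i else (v : ℕ) + 1)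
    (fun v : Fin r => if (v : ℕ) + 1 = i + 1 then i else (v : ℕ) + 1)))

/-- The recursion for the elements `L_{i + 1}`, `i ≥ 1`, in terms of `L = L_i` and
`σ = σ_{i + 1}`. -/
def jmLStep (i : ℕ) (L σ : PartAlg R δ r) : PartAlg R δ r :=
  -(s R δ r i * L * pHalf R δ r i) - pHalf R δ r i * L * s R δ r i
    + pHalf R δ r i * L * p R δ r (i + 1) * pHalf R δ r i + s R δ r i * L * s R δ r i + σ

/-- The recursion for the elements `σ_{i + 1}`, `i ≥ 2`, in terms of `L = L_{i - 1}` and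
`σ = σ_i`. -/
def jmSigmaStep (i : ℕ) (L σ : PartAlg R δ r) : PartAlg R δ r :=
  s R δ r (i - 1) * s R δ r i * σ * s R δ r i * s R δ r (i - 1)
    + s R δ r i * pHalf R δ r (i - 1) * L * s R δ r i * pHalf R δ r (i - 1) * s R δ r i
    + pHalf R δ r (i - 1) * L * s R δ r i * pHalf R δ r (i - 1)
    - s R δ r i * pHalf R δ r (i - 1) * L * s R δ r (i - 1) * pHalf R δ r i * p R δ r i
        * pHalf R δ r (i - 1)
    - pHalf R δ r (i - 1) * p R δ r i * pHalf R δ r i * s R δ r (i - 1) * L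
        * pHalf R δ r (i - 1) * s R δ r i

mutual

/-- `jmL i` is the element `L_i`, `i = 0, 1, 2, …`. -/
def jmL : ℕ → PartAlg R δ r
  | 0 => 0
  | 1 => p R δ r 1
  | j + 2 => jmLStep R δ r (j + 1) (jmL (j + 1)) (jmSigma (j + 2))
termination_by i => 2 * i + 1

/-- `jmSigma i` is the element `σ_i`, `i = 1, 2, …` (the value at `0` is irrelevant). -/
def jmSigma : ℕ → PartAlg R δ r
  | 0 => 1
  | 1 => 1
  | 2 => s R δ r 1
  | j + 3 => jmSigmaStep R δ r (j + 2) (jmL (j + 1)) (jmSigma (j + 2))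
termination_by i => 2 * i

end

/-- The recursion for the elements `σ_{i + 1/2}`, `i ≥ 2`, in terms of `L = L_{i - 1}` and
`σ = σ_{i - 1/2}`. -/
def jmSigmaHalfStep (i : ℕ) (L σ : PartAlg R δ r) : PartAlg R δ r :=
  s R δ r (i - 1) * s R δ r i * σ * s R δ r i * s R δ r (i - 1)
    + pHalf R δ r (i - 1) * L * s R δ r i * pHalf R δ r (i - 1) * s R δ r i
    + s R δ r i * pHalf R δ r (i - 1) * L * s R δ r i * pHalf R δ r (i - 1)
    - pHalf R δ r (i - 1) * L * s R δ r (i - 1) * pHalf R δ r i * p R δ r i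
        * pHalf R δ r (i - 1)
    - s R δ r i * pHalf R δ r (i - 1) * p R δ r i * pHalf R δ r i * s R δ r (i - 1) * L
        * pHalf R δ r (i - 1) * s R δ r i

/-- `jmSigmaHalf i` is the element `σ_{i + 1/2}`, `i = 0, 1, 2, …`. -/
def jmSigmaHalf : ℕ → PartAlg R δ r
  | 0 => 1
  | 1 => 1
  | j + 2 => jmSigmaHalfStep R δ r (j + 2) (jmL R δ r (j + 1)) (jmSigmaHalf (j + 1))

/-- The recursion for the elements `L_{i + 1/2}`, `i ≥ 1`, in terms of `L = L_i`,
`L' = L_{i - 1/2}` and `σ = σ_{i + 1/2}`. -/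
def jmLHalfStep (i : ℕ) (L L' σ : PartAlg R δ r) : PartAlg R δ r :=
  -(L * pHalf R δ r i) - pHalf R δ r i * L + pHalf R δ r i * L * p R δ r i * pHalf R δ r i
    + s R δ r i * L' * s R δ r i + σ

/-- `jmLHalf i` is the element `L_{i + 1/2}`, `i = 0, 1, 2, …`. -/
def jmLHalf : ℕ → PartAlg R δ r
  | 0 => 0
  | j + 1 => jmLHalfStep R δ r (j + 1) (jmL R δ r (j + 1)) (jmLHalf j) (jmSigmaHalf R δ r (j + 1))

end

/-! ### The elements of Halverson and Ram

The vertex `Sum.inl v` (or `Sum.inr v`) lies in `S ∪ S'` exactly when `v ∈ S`. -/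

noncomputable section

/-- For `S ⊆ {1, …, r}` and `I ⊆ S ∪ S'`, the diagram `d_I` whose blocks are `I`, the complement
`I^c = (S ∪ S') \ I` (as far as these are nonempty) and `{ℓ, ℓ'}` for `ℓ ∉ S`. -/
def hrDiag {r : ℕ} (S : Finset (Fin r)) (I : Finset (DiagVertex r)) : PartDiagram r :=
  Setoid.ker fun x : DiagVertex r =>
    if Sum.elim id id x ∈ S then (Sum.inl (x ∈ I) : Prop ⊕ Fin r) else Sum.inr (Sum.elim id id x)

/-- The diagram `b_S` whose blocks are `S ∪ S'` and `{ℓ, ℓ'}` for `ℓ ∉ S`. -/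
def hrBlock {r : ℕ} (S : Finset (Fin r)) : PartDiagram r := hrDiag S ∅

/-- The subset `S ∪ S'` of the set of vertices. -/
def hrDouble {r : ℕ} (S : Finset (Fin r)) : Finset (DiagVertex r) := S.disjSum S

/-- The sign `(-1)^(#{ℓ ∈ S : {ℓ, ℓ'} ⊆ I} + #{ℓ ∈ S : {ℓ, ℓ'} ⊆ I^c})`. -/
def hrSign {r : ℕ} (S : Finset (Fin r)) (I : Finset (DiagVertex r)) : ℂ :=
  (-1) ^ ((S.filter fun l => hrDouble {l} ⊆ I).card +
    (S.filter fun l => hrDouble {l} ⊆ hrDouble S \ I).card)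

/-- The element `p_S`: the sum of `½ · sign · d_I` over all `I ⊆ S ∪ S'` with `I ≠ ∅`,
`I ≠ S ∪ S'` and `I ≠ {ℓ, ℓ'}`, `I ≠ {ℓ, ℓ'}^c` for all `ℓ ∈ S`. -/
def hrP (δ : ℂ) {r : ℕ} (S : Finset (Fin r)) : PartAlg ℂ δ r :=
  ∑ I ∈ (hrDouble S).powerset.filter (fun I => I ≠ ∅ ∧ I ≠ hrDouble S ∧
      ∀ l ∈ S, I ≠ hrDouble {l} ∧ I ≠ hrDouble S \ hrDouble {l}),
    ((1 / 2 : ℂ) * hrSign S I) • diag (hrDiag S I)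

/-- The element `p̃_S`, for `S ∋ m`, where `m` is the last index: the sum of `½ · sign · d_I` over
all `I ⊆ S ∪ S'` with `{m, m'} ⊆ I` or `{m, m'} ⊆ I^c`, `I ≠ ∅`, `I ≠ S ∪ S'` and `I ≠ {ℓ, ℓ'}`,
`I ≠ {ℓ, ℓ'}^c` for all `ℓ ∈ S`, `ℓ ≠ m`. -/
def hrPTilde (δ : ℂ) {r : ℕ} (m : Fin r) (S : Finset (Fin r)) : PartAlg ℂ δ r :=
  ∑ I ∈ (hrDouble S).powerset.filter (fun I =>
      (hrDouble {m} ⊆ I ∨ hrDouble {m} ⊆ hrDouble S \ I) ∧ I ≠ ∅ ∧ I ≠ hrDouble S ∧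
      ∀ l ∈ S, l ≠ m → I ≠ hrDouble {l} ∧ I ≠ hrDouble S \ hrDouble {l}),
    ((1 / 2 : ℂ) * hrSign S I) • diag (hrDiag S I)

/-- The element `Z_k`, for `1 ≤ k ≤ r`, in the algebra on `r` strands. -/
def hrZ (δ : ℂ) (r k : ℕ) : PartAlg ℂ δ r :=
  ((k.choose 2 : ℕ) : ℂ) • 1
  + ∑ S ∈ (Finset.univ.filter fun v : Fin r => (v : ℕ) + 1 ≤ k).powerset.filter
      (fun S => 1 ≤ S.card), hrP δ S
  + ∑ S ∈ (Finset.univ.filter fun v : Fin r => (v : ℕ) + 1 ≤ k).powerset.filter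
      (fun S => 2 ≤ S.card),
      ((δ - k + S.card) * (-1) ^ S.card) • diag (hrBlock S)

/-- The element `Z_{k + 1/2}`, for `1 ≤ k`, in the algebra on `k + 1` strands.  The index `k + 1`
is `Fin.last k`. -/
def hrZHalf (δ : ℂ) (k : ℕ) : PartAlg ℂ δ (k + 1) :=
  (k : ℂ) • 1 + hrZ δ (k + 1) k
  + ∑ S ∈ (Finset.univ : Finset (Fin (k + 1))).powerset.filter
      (fun S => Fin.last k ∈ S ∧ 2 ≤ S.card),
      (hrPTilde δ (Fin.last k) S
        + ((δ - (k + 1) + S.card) * (-1) ^ S.card) • diag (hrBlock S))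

/-- `M_{k + 1/2} = Z_{k + 1/2} - Z_k`, for `1 ≤ k`, in the algebra on `k + 1` strands. -/
def hrMHalf (δ : ℂ) (k : ℕ) : PartAlg ℂ δ (k + 1) := hrZHalf δ k - hrZ δ (k + 1) k

/-- `hrMSucc k` is `M_{k + 1} = Z_{k + 1} - Z_{k + 1/2}`, for `1 ≤ k`, in the algebra on `k + 1`
strands. -/
def hrMSucc (δ : ℂ) (k : ℕ) : PartAlg ℂ δ (k + 1) := hrZ δ (k + 1) (k + 1) - hrZHalf δ k

end

end PartAlg

namespace PartAlg

-- The proof compares two actions on words. For a natural number `N`, the algebra with parameter `N`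
-- acts on functions of words `x` of length `r` in `N` colours: the matrix entry of a diagram at
-- `(x, y)` is 1 if the colouring `x` above, `y` below is constant on blocks, and 0 otherwise
-- (`mat`, `mat_mul`). The action is faithful once `2 * r ≤ N` (`mat_injective`). All elements in
-- question have coefficients polynomial in the parameter, so an identity checked for all large `N`
-- holds for every parameter (`IsPolyFamily.ext`).
--
-- On words everything becomes a partial transposition of colours, `recolor m b c`, which exchanges
-- `b` and `c` in the first `m` letters only. With `a` the colour of letter `i`, `L_i` sends `f` to
-- the function `x ↦ ∑ c, f (recolor i a c x)`, while `L_{i - 1/2}` acts as `N` minus the same sum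
-- with `recolor (i - 1) a c`. The element `σ_{i+1}` exchanges the colours of the letters `i` and `i
-- + 1` throughout the first `i + 1` letters, and `σ_{i+1/2}` exchanges the same colours in the
-- first `i - 1` letters. These formulas satisfy the recursions by a case distinction on which of
-- two or three adjacent letters agree (`ActsAsL.step`, `ActsAsLHalf.step`, `act_jmSigmaStep`,
-- `act_jmSigmaHalfStep`).
--
-- On the Halverson–Ram side, `Z_k` acts as a scalar plus half the sum of all `recolor k b c`, that
-- is, up to a scalar, as the sum of all transpositions of the symmetric group on the colours,
-- applied to the first `k` letters (`act_hrZ`). A transposition of two colours is the identity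
-- minus a rank one matrix on each letter. Multiplying out over letters (the sets `S`) and over
-- vertices (the sets `I`) yields the signed diagrams `d_I` (`recolor_entry`). The excluded sets `I`
-- and the coefficients of `b_S` are a rearrangement of this expansion: for `I = {ℓ, ℓ'}` the
-- diagram `d_I` is `b_{S \ ℓ}`, and is charged to that block (`hrZ_eq`, `hrMHalf_eq`). Passing from
-- `k` to `k + 1` letters affects only transpositions that move the last colour, which gives the
-- formula for `M_{k+1}` (`sum_recolor_succ`).

instance finite_partDiagram (r : ℕ) : Finite (PartDiagram r) :=
  Finite.of_injective (fun d : PartDiagram r => (d : DiagVertex r → DiagVertex r → Prop))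
    fun _ _ h => Setoid.ext fun a b => iff_of_eq (congrFun (congrFun h a) b)

noncomputable instance fintypePartDiagram (r : ℕ) : Fintype (PartDiagram r) := Fintype.ofFinite _

/-! ### The action on coloured words -/

/-- The colouring of an array with three rows given by the colourings of its rows. -/
def rowColor {r : ℕ} {C : Type*} (x z y : Fin r → C) (w : Fin 3 × Fin r) : C :=
  ![x, z, y] w.1 w.2

theorem stack_le_ker_iff {r : ℕ} {C : Type*} (d e : PartDiagram r) (x z y : Fin r → C) :
    diagStack d e ≤ Setoid.ker (rowColor x z y) ↔
      d ≤ Setoid.ker (Sum.elim x z) ∧ e ≤ Setoid.ker (Sum.elim z y) := by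
  rw [diagStack, sup_le_iff, setoid_map_le_iff, setoid_map_le_iff]
  have h1 : Setoid.comap (diagLayer 0 1) (Setoid.ker (rowColor x z y)) =
      Setoid.ker (Sum.elim x z) := by
    ext (v | v) (w | w) <;> rfl
  have h2 : Setoid.comap (diagLayer 1 2) (Setoid.ker (rowColor x z y)) =
      Setoid.ker (Sum.elim z y) := by
    ext (v | v) (w | w) <;> rfl
  rw [h1, h2]

theorem comp_le_ker {r : ℕ} {C : Type*} {d e : PartDiagram r} {x z y : Fin r → C}
    (h : diagStack d e ≤ Setoid.ker (rowColor x z y)) :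
    diagComp d e ≤ Setoid.ker (Sum.elim x y) := by
  rintro (v | v) (w | w) hvw <;> exact h hvw

open Classical in
-- Once the outer rows are coloured compatibly, a component meeting them has its colour forced, and
-- each of the `diagLoops d e` components inside the middle row can be coloured freely. This is why
-- the factor `δ ^ ℓ` of the product matches matrix multiplication when `δ` is the number of
-- colours.
theorem card_middle_colorings {r : ℕ} {C : Type*} (d e : PartDiagram r) (x y : Fin r → C)
    (h : diagComp d e ≤ Setoid.ker (Sum.elim x y)) :
    Nat.card {z : Fin r → C // diagStack d e ≤ Setoid.ker (rowColor x z y)} =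
      Nat.card C ^ diagLoops d e := by
  rw [diagLoops, ← Nat.card_fun]
  have hout : ∀ (z : Fin r → C) (w : DiagVertex r),
      rowColor x z y (diagLayer 0 2 w) = Sum.elim x y w := by
    rintro z (w | w) <;> rfl
  refine Nat.card_eq_of_bijective
    (fun z c => Quotient.lift (rowColor x z.1 y) (fun a b hab => z.2 hab) c.1) ⟨?_, ?_⟩
  · rintro ⟨z, hz⟩ ⟨z', hz'⟩ hzz
    refine Subtype.ext (funext fun v => ?_)
    change z v = z' v
    by_cases hv : ∃ w : DiagVertex r, diagStack d e (diagLayer 0 2 w) (1, v)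
    · obtain ⟨w, hw⟩ := hv
      have e1 : rowColor x z y (diagLayer 0 2 w) = z v := hz hw
      have e2 : rowColor x z' y (diagLayer 0 2 w) = z' v := hz' hw
      rw [← e1, ← e2, hout, hout]
    · exact congrFun hzz ⟨Quotient.mk _ (1, v), fun w hw => hv ⟨w, Quotient.exact hw⟩⟩
  · intro g
    -- Extend the free choice `g` to all components; the chosen outer vertex is immaterial because
    -- the outer colouring is constant on blocks of `diagComp d e`.
    let F : Quotient (diagStack d e) → C := fun c =>
      if hc : ∃ w : DiagVertex r, Quotient.mk _ (diagLayer 0 2 w) = c then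
        Sum.elim x y hc.choose else g ⟨c, fun w hw => hc ⟨w, hw⟩⟩
    have hF : ∀ w : DiagVertex r, F (Quotient.mk _ (diagLayer 0 2 w)) = Sum.elim x y w := by
      intro w
      have hc : ∃ w' : DiagVertex r, Quotient.mk (diagStack d e) (diagLayer 0 2 w') =
        Quotient.mk _ (diagLayer 0 2 w) := ⟨w, rfl⟩
      have h1 : F (Quotient.mk _ (diagLayer 0 2 w)) = Sum.elim x y hc.choose := dif_pos hc
      have h2 : diagComp d e hc.choose w :=
        (Quotient.exact hc.choose_spec : diagStack d e (diagLayer 0 2 hc.choose) (diagLayer 0 2 w))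
      rw [h1]
      exact h h2
    have hz : ∀ u, rowColor x (fun v => F (Quotient.mk _ (1, v))) y u = F (Quotient.mk _ u) := by
      rintro ⟨a, v⟩
      fin_cases a
      · exact (hF (Sum.inl v)).symm
      · rfl
      · exact (hF (Sum.inr v)).symm
    refine ⟨⟨fun v => F (Quotient.mk _ (1, v)), ?_⟩, ?_⟩
    · intro u u' huu
      change rowColor _ _ _ u = rowColor _ _ _ u'
      rw [hz, hz, Quotient.sound huu]
    · funext ⟨c, hc⟩
      induction c using Quotient.ind with
      | _ u =>
      change rowColor _ _ _ u = _
      rw [hz]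
      exact dif_neg fun ⟨w, hw⟩ => hc w hw

open Classical in
/-- The matrix by which an element of the partition algebra acts on the space with basis the
words of length `r` in `N` colours. -/
noncomputable def mat (N r : ℕ) :
    PartAlg ℂ (N : ℂ) r →ₗ[ℂ] Matrix (Fin r → Fin N) (Fin r → Fin N) ℂ :=
  diagBasis.constr ℂ fun d => Matrix.of fun x y =>
    if d ≤ Setoid.ker (Sum.elim x y) then 1 else 0

open Classical in
theorem mat_diag {N r : ℕ} (d : PartDiagram r) (x y : Fin r → Fin N) :
    mat N r (diag d) x y = if d ≤ Setoid.ker (Sum.elim x y) then 1 else 0 := by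
  rw [mat, diag, Module.Basis.constr_basis]
  rfl

theorem mat_diag_mul {N r : ℕ} (d e : PartDiagram r) :
    mat N r (diag d * diag e) = mat N r (diag d) * mat N r (diag e) := by
  classical
  ext x y
  rw [diag_mul_diag, map_smul, Matrix.smul_apply, mat_diag, Matrix.mul_apply, smul_eq_mul]
  simp only [mat_diag, ite_mul, one_mul, zero_mul, ← ite_and, ← stack_le_ker_iff]
  rw [Finset.sum_boole]
  by_cases h : diagComp d e ≤ Setoid.ker (Sum.elim x y)
  · rw [if_pos h, mul_one, ← Fintype.card_subtype, ← Nat.card_eq_fintype_card,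
      card_middle_colorings d e x y h]
    simp
  · rw [if_neg h, mul_zero, eq_comm, Nat.cast_eq_zero, Finset.card_eq_zero,
      Finset.filter_eq_empty_iff]
    exact fun z _ hz => h (comp_le_ker hz)

theorem mat_mul {N r : ℕ} (a b : PartAlg ℂ (N : ℂ) r) : mat N r (a * b) = mat N r a * mat N r b := by
  induction a using induction_diag with
  | h0 => rw [zero_mul, map_zero, zero_mul]
  | hadd a a' h h' => rw [add_mul, map_add, map_add, add_mul, h, h']
  | hs c d =>
  induction b using induction_diag with
  | h0 => rw [mul_zero, map_zero, mul_zero]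
  | hadd b b' h h' => rw [mul_add, map_add, map_add, mul_add, h, h']
  | hs c' e =>
  rw [smul_mul_assoc, mul_smul_comm, map_smul, map_smul, map_smul, map_smul, smul_mul_assoc,
    mul_smul_comm, mat_diag_mul]

theorem mat_one {N r : ℕ} : mat N r 1 = 1 := by
  classical
  ext x y
  change mat N r (diag (diagId r)) x y = _
  rw [mat_diag, Matrix.one_apply]
  refine if_congr ⟨fun h => funext fun v => h (x := Sum.inl v) (y := Sum.inr v) rfl, ?_⟩ rfl rfl
  rintro rfl (v | v) (w | w) h <;> (obtain rfl : v = w := h) <;> rfl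

/-- A diagram has at most `2 * r` blocks, so its blocks can be given distinct colours. -/
theorem exists_ker_eq {N r : ℕ} (hN : 2 * r ≤ N) (d : PartDiagram r) :
    ∃ g : DiagVertex r → Fin N, Setoid.ker g = d := by
  have hc : Nat.card (Quotient d) ≤ N := by
    refine (Nat.card_le_card_of_surjective _ (Quotient.mk_surjective (s := d))).trans ?_
    simpa [two_mul] using hN
  have : Finite (Quotient d) := Quotient.finite d
  obtain ⟨g⟩ : Nonempty (Quotient d ↪ Fin N) := by
    have := Fintype.ofFinite (Quotient d)
    rw [Nat.card_eq_fintype_card] at hc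
    exact Function.Embedding.nonempty_of_card_le (by simpa using hc)
  refine ⟨g ∘ Quotient.mk d, ?_⟩
  ext u v
  exact g.injective.eq_iff.trans Quotient.eq

/-- Triangularity with respect to refinement: at a colouring whose kernel is exactly `d`, only the
diagrams `d' ≤ d` have a nonzero entry, so the coefficients vanish by induction on `d`. -/
theorem mat_injective {N r : ℕ} (hN : 2 * r ≤ N) : Function.Injective (mat N r) := by
  classical
  rw [injective_iff_map_eq_zero]
  intro a ha
  have hexp : ∀ x y : Fin r → Fin N, ∑ d : PartDiagram r,
      diagBasis.repr a d * (if d ≤ Setoid.ker (Sum.elim x y) then 1 else 0) = 0 := by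
    intro x y
    have h := congrFun (congrFun ha x) y
    rw [← diagBasis.sum_repr a, map_sum, Matrix.sum_apply, Matrix.zero_apply] at h
    refine Eq.trans ?_ h
    refine Finset.sum_congr rfl fun d _ => ?_
    rw [map_smul, Matrix.smul_apply, smul_eq_mul]
    congr 1
    exact (mat_diag d x y).symm
  refine diagBasis.ext_elem fun d => ?_
  rw [map_zero, Finsupp.zero_apply]
  induction d using WellFoundedLT.induction with
  | _ d ih =>
  obtain ⟨g, rfl⟩ := exists_ker_eq hN d
  have h := hexp (g ∘ Sum.inl) (g ∘ Sum.inr)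
  rw [Sum.elim_comp_inl_inr, Finset.sum_eq_single (Setoid.ker g)] at h
  · simpa using h
  · intro d' _ hd'
    by_cases hle : d' ≤ Setoid.ker g
    · rw [ih d' (lt_of_le_of_ne hle hd'), zero_mul]
    · rw [if_neg hle, mul_zero]
  · simp

/-! ### Unfolding the recursions -/

section recursion

variable {R : Type*} [CommRing R] {δ : R} {r : ℕ}

theorem jmL_zero : jmL R δ r 0 = 0 := by rw [jmL]

theorem jmL_one : jmL R δ r 1 = p R δ r 1 := by rw [jmL]

theorem jmL_add_two (j : ℕ) :
    jmL R δ r (j + 2) = jmLStep R δ r (j + 1) (jmL R δ r (j + 1)) (jmSigma R δ r (j + 2)) := by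
  rw [jmL]

theorem jmSigma_zero : jmSigma R δ r 0 = 1 := by rw [jmSigma]

theorem jmSigma_one : jmSigma R δ r 1 = 1 := by rw [jmSigma]

theorem jmSigma_two : jmSigma R δ r 2 = s R δ r 1 := by rw [jmSigma]

theorem jmSigma_add_three (j : ℕ) :
    jmSigma R δ r (j + 3) =
      jmSigmaStep R δ r (j + 2) (jmL R δ r (j + 1)) (jmSigma R δ r (j + 2)) := by
  rw [jmSigma]

end recursion

/-! ### Polynomial dependence on the parameter -/

/-- The family `f` of elements of the partition algebras with parameters `δ` has coefficients
that are polynomials in `δ`. -/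
def IsPolyFamily {r : ℕ} (f : ∀ δ : ℂ, PartAlg ℂ δ r) : Prop :=
  ∃ P : PartDiagram r → Polynomial ℂ, ∀ δ, f δ = ∑ d, (P d).eval δ • diag d

namespace IsPolyFamily

variable {r : ℕ} {f g : ∀ δ : ℂ, PartAlg ℂ δ r}

theorem diag (d : PartDiagram r) : IsPolyFamily fun _ => diag d := by
  classical
  refine ⟨fun e => if e = d then 1 else 0, fun δ => ?_⟩
  rw [Finset.sum_eq_single d]
  · simp
  · intro e _ he
    simp [he]
  · simp

theorem one : IsPolyFamily (r := r) fun _ => 1 := diag (diagId r)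

theorem zero : IsPolyFamily (r := r) fun _ => 0 := ⟨fun _ => 0, fun δ => by simp⟩

theorem add (hf : IsPolyFamily f) (hg : IsPolyFamily g) : IsPolyFamily fun δ => f δ + g δ := by
  obtain ⟨P, hP⟩ := hf
  obtain ⟨Q, hQ⟩ := hg
  refine ⟨P + Q, fun δ => ?_⟩
  simp only [hP, hQ, Pi.add_apply, Polynomial.eval_add, add_smul, Finset.sum_add_distrib]

theorem eval_smul (hf : IsPolyFamily f) (p : Polynomial ℂ) :
    IsPolyFamily fun δ => p.eval δ • f δ := by
  obtain ⟨P, hP⟩ := hf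
  refine ⟨fun d => p * P d, fun δ => ?_⟩
  simp only [hP, Finset.smul_sum, Polynomial.eval_mul, smul_smul]

theorem smul (hf : IsPolyFamily f) (c : ℂ) : IsPolyFamily fun δ => c • f δ := by
  simpa using hf.eval_smul (Polynomial.C c)

theorem neg (hf : IsPolyFamily f) : IsPolyFamily fun δ => -f δ := by
  simpa using hf.smul (-1)

theorem sub (hf : IsPolyFamily f) (hg : IsPolyFamily g) : IsPolyFamily fun δ => f δ - g δ := by
  simpa only [sub_eq_add_neg] using hf.add hg.neg

theorem sum {ι : Type*} (s : Finset ι) {F : ι → ∀ δ : ℂ, PartAlg ℂ δ r}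
    (h : ∀ i, IsPolyFamily (F i)) : IsPolyFamily fun δ => ∑ i ∈ s, F i δ := by
  classical
  induction s using Finset.induction_on with
  | empty => simpa only [Finset.sum_empty] using zero
  | insert i s hi ih => simpa only [Finset.sum_insert hi] using (h i).add ih

theorem mul (hf : IsPolyFamily f) (hg : IsPolyFamily g) : IsPolyFamily fun δ => f δ * g δ := by
  obtain ⟨P, hP⟩ := hf
  obtain ⟨Q, hQ⟩ := hg
  have h : (fun δ => f δ * g δ) = fun δ => ∑ d, ∑ e,
      (P d * Q e * Polynomial.X ^ diagLoops d e).eval δ • PartAlg.diag (diagComp d e) := by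
    funext δ
    rw [hP, hQ, Finset.sum_mul_sum]
    refine Finset.sum_congr rfl fun d _ => Finset.sum_congr rfl fun e _ => ?_
    simp only [smul_mul_assoc, mul_smul_comm, diag_mul_diag, smul_smul, Polynomial.eval_mul,
      Polynomial.eval_pow, Polynomial.eval_X]
    congr 1
    ring
  rw [h]
  exact sum _ fun d => sum _ fun e => (diag _).eval_smul _

theorem repr_eq {P : PartDiagram r → Polynomial ℂ} {δ : ℂ}
    (h : f δ = ∑ d, (P d).eval δ • PartAlg.diag d) (d : PartDiagram r) :
    diagBasis.repr (f δ) d = (P d).eval δ := by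
  rw [h]
  exact congrFun (diagBasis.repr_sum_self fun d => (P d).eval δ) d

/-- Two polynomials that agree at all natural numbers from `m` on are equal. The faithful range of
the word action thus suffices for every parameter, including small ones. -/
theorem ext (hf : IsPolyFamily f) (hg : IsPolyFamily g) (m : ℕ)
    (h : ∀ N : ℕ, m ≤ N → f N = g N) (δ : ℂ) : f δ = g δ := by
  obtain ⟨P, hP⟩ := hf
  obtain ⟨Q, hQ⟩ := hg
  have hPQ : P = Q := by
    funext d
    refine Polynomial.eq_of_infinite_eval_eq _ _ ?_
    refine ((Set.Ici_infinite m).image (f := ((↑) : ℕ → ℂ)) Nat.cast_injective.injOn).mono ?_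
    rintro _ ⟨N, hN, rfl⟩
    change (P d).eval (N : ℂ) = (Q d).eval (N : ℂ)
    rw [← repr_eq (hP N), ← repr_eq (hQ N), h N hN]
  rw [hP, hQ, hPQ]

theorem s (i : ℕ) : IsPolyFamily fun δ => PartAlg.s ℂ δ r i := diag _

theorem p (i : ℕ) : IsPolyFamily fun δ => PartAlg.p ℂ δ r i := diag _

theorem pHalf (i : ℕ) : IsPolyFamily fun δ => PartAlg.pHalf ℂ δ r i := diag _

theorem jmLStep (hf : IsPolyFamily f) (hg : IsPolyFamily g) (i : ℕ) :
    IsPolyFamily fun δ => PartAlg.jmLStep ℂ δ r i (f δ) (g δ) :=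
  ((((((s i).mul hf).mul (pHalf i)).neg.sub (((pHalf i).mul hf).mul (s i))).add
    ((((pHalf i).mul hf).mul (p (i + 1))).mul (pHalf i))).add (((s i).mul hf).mul (s i))).add hg

theorem jmLHalfStep {h : ∀ δ : ℂ, PartAlg ℂ δ r} (hf : IsPolyFamily f) (hg : IsPolyFamily g)
    (hh : IsPolyFamily h) (i : ℕ) :
    IsPolyFamily fun δ => PartAlg.jmLHalfStep ℂ δ r i (f δ) (g δ) (h δ) :=
  (((((hf.mul (pHalf i)).neg.sub ((pHalf i).mul hf)).add
    ((((pHalf i).mul hf).mul (p i)).mul (pHalf i)))).add (((s i).mul hg).mul (s i))).add hh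

theorem jmSigmaStep (hf : IsPolyFamily f) (hg : IsPolyFamily g) (i : ℕ) :
    IsPolyFamily fun δ => PartAlg.jmSigmaStep ℂ δ r i (f δ) (g δ) :=
  ((((((((s (i - 1)).mul (s i)).mul hg).mul (s i)).mul (s (i - 1))).add
    (((((((s i).mul (pHalf (i - 1))).mul hf).mul (s i)).mul (pHalf (i - 1))).mul (s i)))).add
    ((((pHalf (i - 1)).mul hf).mul (s i)).mul (pHalf (i - 1)))).sub
    ((((((((s i).mul (pHalf (i - 1))).mul hf).mul (s (i - 1))).mul (pHalf i)).mul (p i)).mul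
      (pHalf (i - 1))))).sub
    (((((((pHalf (i - 1)).mul (p i)).mul (pHalf i)).mul (s (i - 1))).mul hf).mul
      (pHalf (i - 1))).mul (s i))

theorem jmSigmaHalfStep (hf : IsPolyFamily f) (hg : IsPolyFamily g) (i : ℕ) :
    IsPolyFamily fun δ => PartAlg.jmSigmaHalfStep ℂ δ r i (f δ) (g δ) :=
  ((((((((s (i - 1)).mul (s i)).mul hg).mul (s i)).mul (s (i - 1))).add
    (((((pHalf (i - 1)).mul hf).mul (s i)).mul (pHalf (i - 1))).mul (s i))).add
    (((((s i).mul (pHalf (i - 1))).mul hf).mul (s i)).mul (pHalf (i - 1)))).sub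
    ((((((pHalf (i - 1)).mul hf).mul (s (i - 1))).mul (pHalf i)).mul (p i)).mul
      (pHalf (i - 1)))).sub
    ((((((((s i).mul (pHalf (i - 1))).mul (p i)).mul (pHalf i)).mul (s (i - 1))).mul hf).mul
      (pHalf (i - 1))).mul (s i))

/-- Since `σ_{i+1}` depends on `L_{i-1}`, the recursion reaches back two steps, and the induction
has to carry two consecutive indices of both sequences. -/
theorem jmL_jmSigma (i : ℕ) :
    (IsPolyFamily fun δ => jmL ℂ δ r i) ∧ (IsPolyFamily fun δ => jmSigma ℂ δ r i) ∧
    (IsPolyFamily fun δ => jmL ℂ δ r (i + 1)) ∧ IsPolyFamily fun δ => jmSigma ℂ δ r (i + 1) := by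
  induction i with
  | zero =>
    simp only [zero_add, jmL_zero, jmL_one, jmSigma_zero, jmSigma_one]
    exact ⟨zero, one, p 1, one⟩
  | succ i ih =>
    obtain ⟨h1, h2, h3, h4⟩ := ih
    have h5 : IsPolyFamily fun δ => jmSigma ℂ δ r (i + 1 + 1) := by
      cases i with
      | zero =>
        simp only [zero_add, Nat.reduceAdd, jmSigma_two]
        exact s 1
      | succ j =>
        simp only [add_assoc, Nat.reduceAdd, jmSigma_add_three]
        exact h1.jmSigmaStep h4 _
    refine ⟨h3, h4, ?_, h5⟩
    simp only [add_assoc, Nat.reduceAdd, jmL_add_two]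
    exact h3.jmLStep h5 _

theorem jmL (i : ℕ) : IsPolyFamily fun δ => jmL ℂ δ r i := (jmL_jmSigma i).1

theorem jmSigmaHalf (i : ℕ) : IsPolyFamily fun δ => jmSigmaHalf ℂ δ r i := by
  induction i with
  | zero => exact one
  | succ j ih =>
    cases j with
    | zero => exact one
    | succ j => exact (jmL (j + 1)).jmSigmaHalfStep ih _

theorem jmLHalf (i : ℕ) : IsPolyFamily fun δ => jmLHalf ℂ δ r i := by
  induction i with
  | zero => exact zero
  | succ j ih => exact (jmL (j + 1)).jmLHalfStep ih (jmSigmaHalf (j + 1)) _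

theorem hrP (S : Finset (Fin r)) : IsPolyFamily fun δ => hrP δ S :=
  sum _ fun _ => (diag _).smul _

theorem hrPTilde (m : Fin r) (S : Finset (Fin r)) : IsPolyFamily fun δ => hrPTilde δ m S :=
  sum _ fun _ => (diag _).smul _

theorem block_smul (S : Finset (Fin r)) (a b c : ℂ) :
    IsPolyFamily fun δ => ((δ - a + b) * c) • PartAlg.diag (hrBlock S) := by
  have h := (diag (hrBlock S)).eval_smul
    ((Polynomial.X - Polynomial.C a + Polynomial.C b) * Polynomial.C c)
  have he : ∀ δ : ℂ, ((Polynomial.X - Polynomial.C a + Polynomial.C b) *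
      Polynomial.C c).eval δ = (δ - a + b) * c := fun δ => by simp
  simpa only [he] using h

theorem hrZ (k : ℕ) : IsPolyFamily fun δ => hrZ δ r k :=
  ((one.smul _).add (sum _ fun S => hrP S)).add (sum _ fun S => block_smul S _ _ _)

theorem hrZHalf (k : ℕ) : IsPolyFamily fun δ => hrZHalf δ k :=
  ((one.smul _).add (hrZ k)).add
    (sum _ fun S => (hrPTilde _ S).add (block_smul S _ _ _))

end IsPolyFamily

/-! ### The generators as operators on functions of a word -/

/-- The action of the partition algebra on the functions of a word. -/
noncomputable def act {N r : ℕ} (a : PartAlg ℂ (N : ℂ) r) (f : (Fin r → Fin N) → ℂ) :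
    (Fin r → Fin N) → ℂ := (mat N r a).mulVec f

section generators

variable {N r : ℕ} (a b : PartAlg ℂ (N : ℂ) r) (f : (Fin r → Fin N) → ℂ) (x : Fin r → Fin N)

/-- Evaluated at a word `x`, the leftmost factor of a product rewrites `x` first. The computations
below read products from left to right in this sense. -/
theorem act_mul : act (a * b) f = act a (act b f) := by
  rw [act, act, act, mat_mul, Matrix.mulVec_mulVec]

theorem act_one : act 1 f = f := by rw [act, mat_one, Matrix.one_mulVec]

theorem act_zero : act 0 f x = 0 := by rw [act, map_zero, Matrix.zero_mulVec]; rfl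

theorem act_add : act (a + b) f x = act a f x + act b f x := by
  rw [act, map_add, Matrix.add_mulVec]; rfl

theorem act_sub : act (a - b) f x = act a f x - act b f x := by
  rw [act, map_sub, Matrix.sub_mulVec]; rfl

theorem act_neg : act (-a) f x = -act a f x := by
  rw [act, map_neg, Matrix.neg_mulVec]; rfl

variable {a b} in
theorem eq_of_act (hN : 2 * r ≤ N) (h : ∀ f x, act a f x = act b f x) : a = b :=
  mat_injective hN (Matrix.mulVec_injective (funext fun f => funext fun x => h f x))

open Classical in
theorem act_diag (d : PartDiagram r) :
    act (diag d) f x = ∑ y, if d ≤ Setoid.ker (Sum.elim x y) then f y else 0 := by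
  rw [act, Matrix.mulVec, dotProduct]
  simp only [mat_diag, ite_mul, one_mul, zero_mul]

/-- Exchange the letters at the positions `u` and `v`. -/
def swapAt {C : Type*} (u v : Fin r) (x : Fin r → C) : Fin r → C :=
  fun w => if w = u then x v else if w = v then x u else x w

theorem act_s {i : ℕ} {u v : Fin r} (hu : (u : ℕ) + 1 = i) (hv : (v : ℕ) = i) :
    act (s ℂ (N : ℂ) r i) f x = f (swapAt u v x) := by
  classical
  rw [s, act_diag, Finset.sum_eq_single (swapAt u v x)]
  · refine if_pos ?_
    have key : ∀ w : Fin r, swapAt u v x w = x (Equiv.swap u v w) := fun w => by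
      unfold swapAt
      rw [Equiv.swap_apply_def]
      split_ifs <;> rfl
    have key' : ∀ w : Fin r, Equiv.swap i (i + 1) ((w : ℕ) + 1) = (Equiv.swap u v w : Fin r) + 1 := by
      intro w
      simp only [Equiv.swap_apply_def, Fin.ext_iff]
      split_ifs <;> omega
    rintro (w | w) (w' | w') h <;>
      simp only [Setoid.ker_def, Sum.elim_inl, Sum.elim_inr, key', add_left_inj,
        Fin.val_inj] at h ⊢ <;> simp only [key, h]
  · intro y _ hy
    refine if_neg fun h => hy (funext fun w => ?_)
    have h1 : ∀ w w' : Fin r, ((w : ℕ) + 1 = Equiv.swap i (i + 1) ((w' : ℕ) + 1)) → x w = y w' :=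
      fun w w' hw => h (x := Sum.inl w) (y := Sum.inr w') hw
    unfold swapAt
    simp only [Equiv.swap_apply_def] at h1
    split_ifs with h2 h3
    · exact (h1 v w (by subst h2; rw [if_pos hu]; omega)).symm
    · exact (h1 u w (by subst h3; rw [if_neg (by omega), if_pos (by omega)]; omega)).symm
    · refine (h1 w w ?_).symm
      rw [Fin.ext_iff] at h2 h3
      rw [if_neg (by omega), if_neg (by omega)]
  · simp

theorem act_p {i : ℕ} {u : Fin r} (hu : (u : ℕ) + 1 = i) :
    act (p ℂ (N : ℂ) r i) f x = ∑ c, f (Function.update x u c) := by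
  classical
  rw [p, act_diag, ← Finset.sum_filter]
  symm
  refine Finset.sum_nbij (fun c => Function.update x u c) ?_ ?_ ?_ (fun _ _ => rfl)
  · intro c _
    rw [Finset.mem_filter]
    refine ⟨Finset.mem_univ _, ?_⟩
    rintro (w | w) (w' | w') h <;>
      simp only [Setoid.ker_def, Sum.elim_inl, Sum.elim_inr, Prod.mk.injEq, add_left_inj,
        Fin.val_inj] at h ⊢
    · rw [h.1]
    · obtain ⟨rfl, h⟩ := h
      rw [Function.update_of_ne]
      rintro rfl
      exact h.symm.mp hu
    · obtain ⟨rfl, h⟩ := h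
      rw [Function.update_of_ne]
      rintro rfl
      exact h.mp hu
    · rw [h.1]
  · intro c _ c' _ h
    simpa using congrFun h u
  · intro y hy
    rw [Finset.mem_coe, Finset.mem_filter] at hy
    refine ⟨y u, Finset.mem_coe.2 (Finset.mem_univ _), funext fun w => ?_⟩
    by_cases hw : w = u
    · subst hw
      simp
    · dsimp only
      rw [Function.update_of_ne hw]
      refine hy.2 (x := Sum.inl w) (y := Sum.inr w) ?_
      rw [Fin.ext_iff] at hw
      simp only [Setoid.ker_def, Sum.elim_inl, Sum.elim_inr, Prod.mk.injEq, true_and]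
      exact propext ⟨False.elim, fun h => hw (by omega)⟩

theorem act_pHalf {i : ℕ} {u v : Fin r} (hu : (u : ℕ) + 1 = i) (hv : (v : ℕ) = i) :
    act (pHalf ℂ (N : ℂ) r i) f x = if x u = x v then f x else 0 := by
  classical
  rw [pHalf, act_diag, Finset.sum_eq_single x]
  · refine if_congr ⟨fun h => ?_, fun h => ?_⟩ rfl rfl
    · refine h (x := Sum.inl u) (y := Sum.inl v) ?_
      simp only [Setoid.ker_def, Sum.elim_inl, hv, if_true]
      rw [if_neg (by omega)]
      exact hu
    · have key : ∀ w w' : Fin r, (if (w : ℕ) + 1 = i + 1 then i else (w : ℕ) + 1) =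
          (if (w' : ℕ) + 1 = i + 1 then i else (w' : ℕ) + 1) → x w = x w' := by
        intro w w' hw
        have h1 : ∀ w : Fin r, (w : ℕ) + 1 = i + 1 → w = v := fun w hw => Fin.ext (by omega)
        have h2 : ∀ w : Fin r, (w : ℕ) + 1 = i → w = u := fun w hw => Fin.ext (by omega)
        split_ifs at hw with h3 h4 h4
        · rw [h1 w h3, h1 w' h4]
        · rw [h1 w h3, h2 w' hw.symm, h]
        · rw [h1 w' h4, h2 w hw, h]
        · rw [Fin.ext (by omega : (w : ℕ) = w')]
      rintro (w | w) (w' | w') h <;> exact key w w' h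
  · intro y _ hy
    refine if_neg fun h => hy (funext fun w => ?_)
    exact (h (x := Sum.inl w) (y := Sum.inr w) rfl).symm
  · simp

end generators

/-- Exchange the colours `b` and `c` in the first `m` letters of the word `x`. -/
def recolor {r : ℕ} {C : Type*} [DecidableEq C] (m : ℕ) (b c : C) (x : Fin r → C) : Fin r → C :=
  fun w => if (w : ℕ) < m then if x w = b then c else if x w = c then b else x w else x w

-- The recursions for `L_{i+1}` and `L_{i+1/2}` as operations on words

section recursion

variable {N r : ℕ}

/-- `L` acts as `L_{u + 1}`. -/
def ActsAsL (u : Fin r) (L : PartAlg ℂ (N : ℂ) r) : Prop :=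
  ∀ f x, act L f x = ∑ c, f (recolor (u + 1) (x u) c x)

/-- `L` acts as `L_{u + 1 / 2}`. -/
def ActsAsLHalf (u : Fin r) (L : PartAlg ℂ (N : ℂ) r) : Prop :=
  ∀ f x, act L f x = N * f x - ∑ c, f (recolor u (x u) c x)

/-- Exchange `b` and `c` in the letters before `m`, and replace two letters. -/
def recolorTwo {C : Type*} [DecidableEq C] (m : ℕ) (u v : Fin r) (b c : C) (α β : C)
    (x : Fin r → C) : Fin r → C :=
  fun w => if w = u then α else if w = v then β else recolor m b c x w

/-- Conjugating `L` by the transposition moves the distinguished letter from `u` to `v`, but leaves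
the letter at `u` unrecoloured. The other four terms repair this, and each term is expressed through
`Y b c α β`: exchange `b`, `c` before `u`, then write `α`, `β` at `u`, `v`. -/
theorem ActsAsL.step {u v : Fin r} (huv : (v : ℕ) = u + 1) {L σ : PartAlg ℂ (N : ℂ) r}
    (hL : ActsAsL u L) (hσ : ∀ f x, act σ f x = f (recolor (u + 2) (x u) (x v) x)) :
    ActsAsL v (jmLStep ℂ (N : ℂ) r (u + 1) L σ) := by
  intro f x
  set Y : Fin N → Fin N → Fin N → Fin N → (Fin r → Fin N) :=
    fun b c α β => recolorTwo u u v b c α β x with hY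
  have hne : u ≠ v := fun h => by rw [h] at huv; omega
  have hs := fun f x => act_s (N := N) (r := r) f x (i := u + 1) (u := u) (v := v) rfl huv
  have hh := fun f x => act_pHalf (N := N) (r := r) f x (i := u + 1) (u := u) (v := v) rfl huv
  have hp := fun f x => act_p (N := N) (r := r) f x (i := v + 1) (u := v) rfl
  rw [huv] at hp
  have t1 : act (s ℂ (N : ℂ) r (u + 1) * L * pHalf ℂ (N : ℂ) r (u + 1)) f x =
      f (Y (x v) (x u) (x u) (x u)) := by
    simp only [act_mul, hs, hL _ _, hh]
    -- After the swap, `L` writes `c` at `u` while `x u` stands at `v`; `pHalf` keeps only the word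
    -- in which they agree.
    rw [Finset.sum_eq_single (x u)]
    · rw [if_pos]
      · congr 1
        funext w
        simp only [hY, recolorTwo, recolor, swapAt]
        grind
      · simp only [recolor, swapAt]
        grind
    · intro c _ hc
      rw [if_neg]
      simp only [recolor, swapAt]
      grind
    · simp
  have t2 : act (pHalf ℂ (N : ℂ) r (u + 1) * L * s ℂ (N : ℂ) r (u + 1)) f x =
      if x u = x v then ∑ c, f (Y (x u) c (x v) c) else 0 := by
    simp only [act_mul, hs, hL _ _, hh]
    refine if_congr Iff.rfl (Finset.sum_congr rfl fun c _ => congrArg f (funext fun w => ?_)) rfl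
    simp only [hY, recolorTwo, recolor, swapAt]
    grind
  have t3 : act (pHalf ℂ (N : ℂ) r (u + 1) * L * p ℂ (N : ℂ) r (u + 1 + 1) *
      pHalf ℂ (N : ℂ) r (u + 1)) f x = if x u = x v then ∑ c, f (Y (x u) c c c) else 0 := by
    simp only [act_mul, hp, hL _ _, hh]
    refine if_congr Iff.rfl (Finset.sum_congr rfl fun c _ => ?_) rfl
    rw [Finset.sum_eq_single c]
    · rw [if_pos]
      · congr 1
        funext w
        simp only [hY, recolorTwo, recolor, Function.update_apply]
        grind
      · simp only [recolor, Function.update_apply]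
        grind
    · intro e _ he
      rw [if_neg]
      simp only [recolor, Function.update_apply]
      grind
    · simp
  have t4 : act (s ℂ (N : ℂ) r (u + 1) * L * s ℂ (N : ℂ) r (u + 1)) f x =
      ∑ c, f (Y (x v) c (x u) c) := by
    simp only [act_mul, hs, hL _ _]
    refine Finset.sum_congr rfl fun c _ => congrArg f (funext fun w => ?_)
    simp only [hY, recolorTwo, recolor, swapAt]
    grind
  have t5 : act σ f x = f (Y (x u) (x v) (x v) (x u)) := by
    rw [hσ]
    refine congrArg f (funext fun w => ?_)
    simp only [hY, recolorTwo, recolor]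
    grind
  have t6 : ∑ c, f (recolor (v + 1) (x v) c x) =
      ∑ c, f (Y (x v) c (if x u = x v then c else if x u = c then x v else x u) c) := by
    refine Finset.sum_congr rfl fun c _ => congrArg f (funext fun w => ?_)
    simp only [hY, recolorTwo, recolor]
    grind
  rw [jmLStep, act_add, act_add, act_add, act_sub, act_neg, t1, t2, t3, t4, t5, t6]
  -- For equal letters `t2` cancels `t4`, `t1` cancels `t5`, and `t3` is the result. For distinct
  -- letters `t2` and `t3` vanish, and `t4` is wrong only at `c = x u`; there `t1` removes the wrong
  -- summand and `σ` supplies the right one.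
  by_cases hab : x u = x v
  · simp only [hab, if_true]
    ring
  · simp only [hab, if_false]
    rw [← Finset.add_sum_erase _ _ (Finset.mem_univ (x u)),
      ← Finset.add_sum_erase (a := x u) _ (fun c => f (Y (x v) c (if x u = c then x v else x u) c))
        (Finset.mem_univ (x u))]
    rw [Finset.sum_congr (g := fun c => f (Y (x v) c (if x u = c then x v else x u) c)) rfl
      fun c hc => by rw [if_neg (Finset.ne_of_mem_erase hc).symm]]
    have h1 : Y (x u) (x v) (x v) (x u) = Y (x v) (x u) (x v) (x u) := by
      funext w
      simp only [hY, recolorTwo, recolor]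
      grind
    rw [if_pos rfl, h1]
    ring

theorem ActsAsLHalf.step {u v : Fin r} (huv : (v : ℕ) = u + 1) {L L' σ : PartAlg ℂ (N : ℂ) r}
    (hL : ActsAsL u L) (hL' : ActsAsLHalf u L')
    (hσ : ∀ f x, act σ f x = f (recolor u (x u) (x v) x)) :
    ActsAsLHalf v (jmLHalfStep ℂ (N : ℂ) r (u + 1) L L' σ) := by
  intro f x
  set Y : Fin N → Fin N → Fin N → Fin N → (Fin r → Fin N) :=
    fun b c α β => recolorTwo u u v b c α β x with hY
  have hne : u ≠ v := fun h => by rw [h] at huv; omega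
  have hs := fun f x => act_s (N := N) (r := r) f x (i := u + 1) (u := u) (v := v) rfl huv
  have hh := fun f x => act_pHalf (N := N) (r := r) f x (i := u + 1) (u := u) (v := v) rfl huv
  have hp := fun f x => act_p (N := N) (r := r) f x (i := u + 1) (u := u) rfl
  have t1 : act (L * pHalf ℂ (N : ℂ) r (u + 1)) f x = f (Y (x u) (x v) (x v) (x v)) := by
    simp only [act_mul, hL _ _, hh]
    rw [Finset.sum_eq_single (x v)]
    · rw [if_pos]
      · congr 1
        funext w
        simp only [hY, recolorTwo, recolor]
        grind
      · simp only [recolor]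
        grind
    · intro c _ hc
      rw [if_neg]
      simp only [recolor]
      grind
    · simp
  have t2 : act (pHalf ℂ (N : ℂ) r (u + 1) * L) f x =
      if x u = x v then ∑ c, f (Y (x u) c c (x v)) else 0 := by
    simp only [act_mul, hL _ _, hh]
    refine if_congr Iff.rfl (Finset.sum_congr rfl fun c _ => congrArg f (funext fun w => ?_)) rfl
    simp only [hY, recolorTwo, recolor]
    grind
  have t3 : act (pHalf ℂ (N : ℂ) r (u + 1) * L * p ℂ (N : ℂ) r (u + 1) *
      pHalf ℂ (N : ℂ) r (u + 1)) f x =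
      if x u = x v then ∑ c, f (Y (x u) c (x v) (x v)) else 0 := by
    simp only [act_mul, hp, hL _ _, hh]
    refine if_congr Iff.rfl (Finset.sum_congr rfl fun c _ => ?_) rfl
    rw [Finset.sum_eq_single (x v)]
    · rw [if_pos]
      · congr 1
        funext w
        simp only [hY, recolorTwo, recolor, Function.update_apply]
        grind
      · simp only [recolor, Function.update_apply]
        grind
    · intro e _ he
      rw [if_neg]
      simp only [recolor, Function.update_apply]
      grind
    · simp
  have t4 : act (s ℂ (N : ℂ) r (u + 1) * L' * s ℂ (N : ℂ) r (u + 1)) f x =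
      N * f x - ∑ c, f (Y (x v) c (x u) (x v)) := by
    simp only [act_mul, hs, hL' _ _]
    congr 1
    · congr 2
      funext w
      simp only [swapAt]
      grind
    · refine Finset.sum_congr rfl fun c _ => congrArg f (funext fun w => ?_)
      simp only [hY, recolorTwo, recolor, swapAt]
      grind
  have t5 : act σ f x = f (Y (x u) (x v) (x u) (x v)) := by
    rw [hσ]
    refine congrArg f (funext fun w => ?_)
    simp only [hY, recolorTwo, recolor]
    grind
  have t6 : ∑ c, f (recolor v (x v) c x) =
      ∑ c, f (Y (x v) c (if x u = x v then c else if x u = c then x v else x u) (x v)) := by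
    refine Finset.sum_congr rfl fun c _ => congrArg f (funext fun w => ?_)
    simp only [hY, recolorTwo, recolor]
    grind
  rw [jmLHalfStep, act_add, act_add, act_add, act_sub, act_neg, t1, t2, t3, t4, t5, t6]
  -- For equal letters `t3` cancels the sum in `t4`, `t1` cancels `t5`, and `t2` supplies the sum.
  -- For distinct letters the summand of `t4` at `c = x u` is wrong; here `σ` removes it and `t1`
  -- supplies the right one.
  by_cases hab : x u = x v
  · simp only [hab, if_true]
    ring
  · simp only [hab, if_false]
    rw [← Finset.add_sum_erase _ _ (Finset.mem_univ (x u)),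
      ← Finset.add_sum_erase (a := x u) _
        (fun c => f (Y (x v) c (if x u = c then x v else x u) (x v))) (Finset.mem_univ (x u))]
    rw [Finset.sum_congr (g := fun c => f (Y (x v) c (if x u = c then x v else x u) (x v))) rfl
      fun c hc => by rw [if_neg (Finset.ne_of_mem_erase hc).symm]]
    have h1 : ∀ α β, Y (x u) (x v) α β = Y (x v) (x u) α β := by
      intro α β
      funext w
      simp only [hY, recolorTwo, recolor]
      grind
    rw [if_pos rfl, h1, h1]
    ring

end recursion

-- The recursions for `σ_{i+1}` and `σ_{i+1/2}`, and the action of all recursive elements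

section recursion

variable {N r : ℕ}

/-- Exchange `b` and `c` in the letters before `t`, and replace three letters. -/
def recolorThree {C : Type*} [DecidableEq C] (t u v : Fin r) (b c : C) (α β γ : C)
    (x : Fin r → C) : Fin r → C :=
  fun w => if w = t then α else recolorTwo t u v b c β γ x w

/-- Collapses the sum over colours coming from `L` or from `p` when a neighbouring `pHalf` pins the
colour to one value. -/
theorem sum_ite_recolor {M : Type*} [AddCommMonoid M] {C : Type*} [Fintype C] [DecidableEq C]
    {P : C → Prop} [DecidablePred P] (c : C) (hP : ∀ c', P c' ↔ c' = c) (g : C → M) (y : M)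
    (hy : g c = y) : ∑ c', (if P c' then g c' else 0) = y := by
  rw [← hy, Finset.sum_eq_single c]
  · rw [if_pos ((hP c).2 rfl)]
  · intro c' _ hc
    rw [if_neg fun h => hc ((hP c').1 h)]
  · simp

/-- Conjugating the previous `σ` moves its two colours to `u` and `v` but carries the letter at `t`
through unchanged, whereas it should be recoloured too. The four correction terms act only if `x t`
equals `x u` or `x v`. -/
theorem act_jmSigmaStep {t u v : Fin r} (htu : (u : ℕ) = t + 1) (huv : (v : ℕ) = t + 2)
    {L σ : PartAlg ℂ (N : ℂ) r}
    (hL : ActsAsL t L) (hσ : ∀ f x, act σ f x = f (recolor (t + 2) (x t) (x u) x))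
    (f : (Fin r → Fin N) → ℂ) (x : Fin r → Fin N) :
    act (jmSigmaStep ℂ (N : ℂ) r (t + 2) L σ) f x = f (recolor (t + 3) (x u) (x v) x) := by
  set Y : Fin N → Fin N → Fin N → (Fin r → Fin N) :=
    fun α β γ => recolorThree t u v (x u) (x v) α β γ x with hY
  have hne : t ≠ u := fun h => by rw [h] at htu; omega
  have hne' : t ≠ v := fun h => by rw [h] at huv; omega
  have hne'' : u ≠ v := fun h => by rw [h] at htu; omega
  have hs := fun f x => act_s (N := N) (r := r) f x (i := t + 2) (u := u) (v := v) (by omega) huv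
  have hh := fun f x =>
    act_pHalf (N := N) (r := r) f x (i := t + 2) (u := u) (v := v) (by omega) huv
  have hs' := fun f x => act_s (N := N) (r := r) f x (i := t + 1) (u := t) (v := u) rfl htu
  have hg := fun f x => act_pHalf (N := N) (r := r) f x (i := t + 1) (u := t) (v := u) rfl htu
  have hp := fun f x => act_p (N := N) (r := r) f x (i := t + 2) (u := u) (by omega)
  have t1 : act (s ℂ (N : ℂ) r (t + 1) * s ℂ (N : ℂ) r (t + 2) * σ * s ℂ (N : ℂ) r (t + 2) *
      s ℂ (N : ℂ) r (t + 1)) f x = f (Y (x t) (x v) (x u)) := by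
    simp only [act_mul, hs, hs', hσ]
    refine congrArg f (funext fun w => ?_)
    simp only [hY, recolorThree, recolorTwo, recolor, swapAt]
    grind
  have t2 : act (s ℂ (N : ℂ) r (t + 2) * pHalf ℂ (N : ℂ) r (t + 1) * L * s ℂ (N : ℂ) r (t + 2) *
      pHalf ℂ (N : ℂ) r (t + 1) * s ℂ (N : ℂ) r (t + 2)) f x =
      if x t = x v then f (Y (x u) (x v) (x u)) else 0 := by
    simp only [act_mul, hs, hL _ _, hg]
    refine if_ctx_congr ?_ (fun h => ?_) fun _ => rfl
    · simp only [swapAt]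
      grind
    · refine sum_ite_recolor (x u) (fun c => ?_) _ _ (congrArg f (funext fun w => ?_))
      · simp only [recolor, swapAt]
        grind
      · simp only [hY, recolorThree, recolorTwo, recolor, swapAt]
        grind
  have t3 : act (pHalf ℂ (N : ℂ) r (t + 1) * L * s ℂ (N : ℂ) r (t + 2) *
      pHalf ℂ (N : ℂ) r (t + 1)) f x =
      if x t = x u then f (Y (x v) (x v) (x u)) else 0 := by
    simp only [act_mul, hs, hL _ _, hg]
    refine if_ctx_congr Iff.rfl (fun h => ?_) fun _ => rfl
    refine sum_ite_recolor (x v) (fun c => ?_) _ _ (congrArg f (funext fun w => ?_))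
    · simp only [recolor, swapAt]
      grind
    · simp only [hY, recolorThree, recolorTwo, recolor, swapAt]
      grind
  have t4 : act (s ℂ (N : ℂ) r (t + 2) * pHalf ℂ (N : ℂ) r (t + 1) * L * s ℂ (N : ℂ) r (t + 1) *
      pHalf ℂ (N : ℂ) r (t + 2) * p ℂ (N : ℂ) r (t + 2) * pHalf ℂ (N : ℂ) r (t + 1)) f x =
      if x t = x v then f (Y (x v) (x v) (x u)) else 0 := by
    simp only [act_mul, hs, hs', hL _ _, hg, hh, hp]
    refine if_ctx_congr ?_ (fun h => ?_) fun _ => rfl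
    · simp only [swapAt]
      grind
    · refine sum_ite_recolor (x u) (fun c => ?_) _ _ ?_
      · simp only [recolor, swapAt]
        grind
      · refine sum_ite_recolor (x v) (fun c => ?_) _ _ (congrArg f (funext fun w => ?_))
        · simp only [recolor, swapAt, Function.update_apply]
          grind
        · simp only [hY, recolorThree, recolorTwo, recolor, swapAt, Function.update_apply]
          grind
  have t5 : act (pHalf ℂ (N : ℂ) r (t + 1) * p ℂ (N : ℂ) r (t + 2) * pHalf ℂ (N : ℂ) r (t + 2) *
      s ℂ (N : ℂ) r (t + 1) * L * pHalf ℂ (N : ℂ) r (t + 1) * s ℂ (N : ℂ) r (t + 2)) f x =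
      if x t = x u then f (Y (x u) (x v) (x u)) else 0 := by
    simp only [act_mul, hs, hs', hL _ _, hg, hh, hp]
    refine if_ctx_congr Iff.rfl (fun h => ?_) fun _ => rfl
    refine sum_ite_recolor (x v) (fun c => ?_) _ _ ?_
    · simp only [Function.update_apply]
      grind
    · refine sum_ite_recolor (x u) (fun c => ?_) _ _ (congrArg f (funext fun w => ?_))
      · simp only [recolor, swapAt, Function.update_apply]
        grind
      · simp only [hY, recolorThree, recolorTwo, recolor, swapAt, Function.update_apply]
        grind
  have t6 : recolor (t + 3) (x u) (x v) x =
      Y (if x t = x u then x v else if x t = x v then x u else x t) (x v) (x u) := by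
    funext w
    simp only [hY, recolorThree, recolorTwo, recolor]
    grind
  rw [jmSigmaStep, show (t : ℕ) + 2 - 1 = t + 1 from rfl, act_sub, act_sub, act_add, act_add,
    t1, t2, t3, t4, t5, t6]
  -- If only `x t = x u`, then `t5` cancels `t1` and `t3` is the result; if only `x t = x v`, then
  -- `t4` cancels `t1` and `t2` is the result. If all three letters agree, all five terms coincide
  -- and the signs add up to 1.
  by_cases h1 : x t = x u <;> by_cases h2 : x t = x v
  · rw [if_pos h1, if_pos h1, if_pos h1, if_pos h2, if_pos h2, ← h1, ← h2]
    ring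
  · rw [if_pos h1, if_pos h1, if_pos h1, if_neg h2, if_neg h2, ← h1]
    ring
  · rw [if_neg h1, if_neg h1, if_neg h1, if_pos h2, if_pos h2, if_pos h2, ← h2]
    ring
  · rw [if_neg h1, if_neg h1, if_neg h1, if_neg h2, if_neg h2, if_neg h2]
    ring

theorem act_jmSigmaHalfStep {t u v : Fin r} (htu : (u : ℕ) = t + 1) (huv : (v : ℕ) = t + 2)
    {L σ : PartAlg ℂ (N : ℂ) r}
    (hL : ActsAsL t L) (hσ : ∀ f x, act σ f x = f (recolor t (x t) (x u) x))
    (f : (Fin r → Fin N) → ℂ) (x : Fin r → Fin N) :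
    act (jmSigmaHalfStep ℂ (N : ℂ) r (t + 2) L σ) f x = f (recolor (t + 1) (x u) (x v) x) := by
  set Y : Fin N → Fin N → Fin N → (Fin r → Fin N) :=
    fun α β γ => recolorThree t u v (x u) (x v) α β γ x with hY
  have hne : t ≠ u := fun h => by rw [h] at htu; omega
  have hne' : t ≠ v := fun h => by rw [h] at huv; omega
  have hne'' : u ≠ v := fun h => by rw [h] at htu; omega
  have hs := fun f x => act_s (N := N) (r := r) f x (i := t + 2) (u := u) (v := v) (by omega) huv
  have hh := fun f x =>
    act_pHalf (N := N) (r := r) f x (i := t + 2) (u := u) (v := v) (by omega) huv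
  have hs' := fun f x => act_s (N := N) (r := r) f x (i := t + 1) (u := t) (v := u) rfl htu
  have hg := fun f x => act_pHalf (N := N) (r := r) f x (i := t + 1) (u := t) (v := u) rfl htu
  have hp := fun f x => act_p (N := N) (r := r) f x (i := t + 2) (u := u) (by omega)
  have t1 : act (s ℂ (N : ℂ) r (t + 1) * s ℂ (N : ℂ) r (t + 2) * σ * s ℂ (N : ℂ) r (t + 2) *
      s ℂ (N : ℂ) r (t + 1)) f x = f (Y (x t) (x u) (x v)) := by
    simp only [act_mul, hs, hs', hσ]
    refine congrArg f (funext fun w => ?_)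
    simp only [hY, recolorThree, recolorTwo, recolor, swapAt]
    grind
  have t2 : act (pHalf ℂ (N : ℂ) r (t + 1) * L * s ℂ (N : ℂ) r (t + 2) *
      pHalf ℂ (N : ℂ) r (t + 1) * s ℂ (N : ℂ) r (t + 2)) f x =
      if x t = x u then f (Y (x v) (x u) (x v)) else 0 := by
    simp only [act_mul, hs, hL _ _, hg]
    refine if_ctx_congr Iff.rfl (fun h => ?_) fun _ => rfl
    refine sum_ite_recolor (x v) (fun c => ?_) _ _ (congrArg f (funext fun w => ?_))
    · simp only [recolor, swapAt]
      grind
    · simp only [hY, recolorThree, recolorTwo, recolor, swapAt]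
      grind
  have t3 : act (s ℂ (N : ℂ) r (t + 2) * pHalf ℂ (N : ℂ) r (t + 1) * L * s ℂ (N : ℂ) r (t + 2) *
      pHalf ℂ (N : ℂ) r (t + 1)) f x =
      if x t = x v then f (Y (x u) (x u) (x v)) else 0 := by
    simp only [act_mul, hs, hL _ _, hg]
    refine if_ctx_congr ?_ (fun h => ?_) fun _ => rfl
    · simp only [swapAt]
      grind
    · refine sum_ite_recolor (x u) (fun c => ?_) _ _ (congrArg f (funext fun w => ?_))
      · simp only [recolor, swapAt]
        grind
      · simp only [hY, recolorThree, recolorTwo, recolor, swapAt]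
        grind
  have t4 : act (pHalf ℂ (N : ℂ) r (t + 1) * L * s ℂ (N : ℂ) r (t + 1) *
      pHalf ℂ (N : ℂ) r (t + 2) * p ℂ (N : ℂ) r (t + 2) * pHalf ℂ (N : ℂ) r (t + 1)) f x =
      if x t = x u then f (Y (x u) (x u) (x v)) else 0 := by
    simp only [act_mul, hs', hL _ _, hg, hh, hp]
    refine if_ctx_congr Iff.rfl (fun h => ?_) fun _ => rfl
    refine sum_ite_recolor (x v) (fun c => ?_) _ _ ?_
    · simp only [recolor, swapAt]
      grind
    · refine sum_ite_recolor (x u) (fun c => ?_) _ _ (congrArg f (funext fun w => ?_))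
      · simp only [recolor, swapAt, Function.update_apply]
        grind
      · simp only [hY, recolorThree, recolorTwo, recolor, swapAt, Function.update_apply]
        grind
  have t5 : act (s ℂ (N : ℂ) r (t + 2) * pHalf ℂ (N : ℂ) r (t + 1) * p ℂ (N : ℂ) r (t + 2) *
      pHalf ℂ (N : ℂ) r (t + 2) * s ℂ (N : ℂ) r (t + 1) * L * pHalf ℂ (N : ℂ) r (t + 1) *
      s ℂ (N : ℂ) r (t + 2)) f x =
      if x t = x v then f (Y (x v) (x u) (x v)) else 0 := by
    simp only [act_mul, hs, hs', hL _ _, hg, hh, hp]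
    refine if_ctx_congr ?_ (fun h => ?_) fun _ => rfl
    · simp only [swapAt]
      grind
    · refine sum_ite_recolor (x u) (fun c => ?_) _ _ ?_
      · simp only [swapAt, Function.update_apply]
        grind
      · refine sum_ite_recolor (x v) (fun c => ?_) _ _ (congrArg f (funext fun w => ?_))
        · simp only [recolor, swapAt, Function.update_apply]
          grind
        · simp only [hY, recolorThree, recolorTwo, recolor, swapAt, Function.update_apply]
          grind
  have t6 : recolor (t + 1) (x u) (x v) x =
      Y (if x t = x u then x v else if x t = x v then x u else x t) (x u) (x v) := by
    funext w
    simp only [hY, recolorThree, recolorTwo, recolor]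
    grind
  rw [jmSigmaHalfStep, show (t : ℕ) + 2 - 1 = t + 1 from rfl, act_sub, act_sub, act_add, act_add,
    t1, t2, t3, t4, t5, t6]
  -- If only `x t = x u`, then `t4` cancels `t1` and `t2` is the result; if only `x t = x v`, then
  -- `t5` cancels `t1` and `t3` is the result. Equal letters give five coinciding terms with signs
  -- adding up to 1.
  by_cases h1 : x t = x u <;> by_cases h2 : x t = x v
  · rw [if_pos h1, if_pos h1, if_pos h1, if_pos h2, if_pos h2, ← h1, ← h2]
    ring
  · rw [if_pos h1, if_pos h1, if_pos h1, if_neg h2, if_neg h2, ← h1]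
    ring
  · rw [if_neg h1, if_neg h1, if_neg h1, if_pos h2, if_pos h2, if_pos h2, ← h2]
    ring
  · rw [if_neg h1, if_neg h1, if_neg h1, if_neg h2, if_neg h2, if_neg h2]
    ring

/-- Positions in `Fin r` start at 0, so position `j` carries `L_{j+1}`, and `σ_{j+2}` belongs to the
positions `j`, `j + 1`. As with the recursion itself, two consecutive `L` have to be carried along.
-/
theorem act_jmL_jmSigma (j : ℕ) :
    (∀ u : Fin r, (u : ℕ) = j → ActsAsL u (jmL ℂ (N : ℂ) r (j + 1))) ∧
    (∀ u v : Fin r, (u : ℕ) = j → (v : ℕ) = j + 1 → ∀ f x,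
      act (jmSigma ℂ (N : ℂ) r (j + 2)) f x = f (recolor (j + 2) (x u) (x v) x)) ∧
    (∀ u : Fin r, (u : ℕ) = j + 1 → ActsAsL u (jmL ℂ (N : ℂ) r (j + 2))) := by
  induction j with
  | zero =>
    have h1 : ∀ u : Fin r, (u : ℕ) = 0 → ActsAsL u (jmL ℂ (N : ℂ) r 1) := by
      intro u hu f x
      rw [jmL_one, act_p f x (i := 1) (u := u) (by omega)]
      refine Finset.sum_congr rfl fun c _ => congrArg f (funext fun w => ?_)
      simp only [recolor, Function.update_apply]
      grind
    have h2 : ∀ u v : Fin r, (u : ℕ) = 0 → (v : ℕ) = 0 + 1 → ∀ f x,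
        act (jmSigma ℂ (N : ℂ) r 2) f x = f (recolor 2 (x u) (x v) x) := by
      intro u v hu hv f x
      rw [jmSigma_two, act_s f x (i := 1) (u := u) (v := v) (by omega) (by omega)]
      refine congrArg f (funext fun w => ?_)
      simp only [recolor, swapAt]
      grind
    refine ⟨h1, h2, fun v hv => ?_⟩
    obtain ⟨u, hu⟩ : ∃ u : Fin r, (u : ℕ) = 0 := ⟨⟨0, by omega⟩, rfl⟩
    have h := ActsAsL.step (u := u) (v := v) (by omega) (h1 u hu)
      (by rw [hu]; exact h2 u v hu hv)
    rw [hu] at h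
    rw [jmL_add_two]
    exact h
  | succ j ih =>
    obtain ⟨h1, h2, h3⟩ := ih
    have h4 : ∀ u v : Fin r, (u : ℕ) = j + 1 → (v : ℕ) = j + 1 + 1 → ∀ f x,
        act (jmSigma ℂ (N : ℂ) r (j + 1 + 2)) f x = f (recolor (j + 1 + 2) (x u) (x v) x) := by
      intro u v hu hv f x
      obtain ⟨t, ht⟩ : ∃ t : Fin r, (t : ℕ) = j := ⟨⟨j, by omega⟩, rfl⟩
      have h := act_jmSigmaStep (t := t) (u := u) (v := v) (by omega) (by omega) (h1 t ht)
        (by rw [ht]; exact h2 t u ht hu) f x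
      rw [ht] at h
      rw [show j + 1 + 2 = j + 3 from rfl, jmSigma_add_three]
      exact h
    refine ⟨h3, h4, fun v hv => ?_⟩
    obtain ⟨u, hu⟩ : ∃ u : Fin r, (u : ℕ) = j + 1 := ⟨⟨j + 1, by omega⟩, rfl⟩
    have h := ActsAsL.step (u := u) (v := v) (by omega) (h3 u hu)
      (by rw [hu]; exact h4 u v hu hv)
    rw [hu] at h
    rw [jmL_add_two]
    exact h

theorem act_jmL (u : Fin r) : ActsAsL u (jmL ℂ (N : ℂ) r (u + 1)) :=
  (act_jmL_jmSigma (u : ℕ)).1 u rfl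

theorem act_jmSigmaHalf (j : ℕ) (u v : Fin r) (hu : (u : ℕ) = j) (hv : (v : ℕ) = j + 1)
    (f : (Fin r → Fin N) → ℂ) (x : Fin r → Fin N) :
    act (jmSigmaHalf ℂ (N : ℂ) r (j + 1)) f x = f (recolor j (x u) (x v) x) := by
  induction j generalizing u v f x with
  | zero =>
    rw [show jmSigmaHalf ℂ (N : ℂ) r (0 + 1) = 1 from rfl, act_one]
    rfl
  | succ j ih =>
    obtain ⟨t, ht⟩ : ∃ t : Fin r, (t : ℕ) = j := ⟨⟨j, by omega⟩, rfl⟩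
    have h := act_jmSigmaHalfStep (t := t) (u := u) (v := v) (by omega) (by omega) (act_jmL t)
      (by rw [ht]; exact fun f x => ih t u ht hu f x) f x
    rw [ht] at h
    exact h

theorem act_jmLHalf (j : ℕ) (u : Fin r) (hu : (u : ℕ) = j) :
    ActsAsLHalf u (jmLHalf ℂ (N : ℂ) r j) := by
  induction j generalizing u with
  | zero =>
    intro f x
    rw [show jmLHalf ℂ (N : ℂ) r 0 = 0 from rfl, act_zero, hu]
    -- No letter precedes the first one, so all `N` summands equal `f x` and cancel `N * f x`, in
    -- accordance with `L_{1/2} = 0`.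
    have h : ∀ c, recolor 0 (x u) c x = x := fun c => rfl
    simp only [h, Finset.sum_const, Finset.card_univ, Fintype.card_fin, nsmul_eq_mul, sub_self]
  | succ j ih =>
    obtain ⟨t, ht⟩ : ∃ t : Fin r, (t : ℕ) = j := ⟨⟨j, by omega⟩, rfl⟩
    have h := ActsAsLHalf.step (u := t) (v := u) (by omega) (act_jmL t) (ih t ht)
      (by rw [ht]; exact act_jmSigmaHalf j t u ht hu)
    rw [ht] at h
    exact h

end recursion

/-! ### The diagrams of Halverson and Ram -/

section diagrams

variable {r : ℕ} {S : Finset (Fin r)} {I : Finset (DiagVertex r)} {v : DiagVertex r} {l : Fin r}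

theorem mem_hrDouble : v ∈ hrDouble S ↔ Sum.elim id id v ∈ S := by
  cases v <;> simp [hrDouble]

theorem hrDouble_singleton_subset : hrDouble {l} ⊆ I ↔ Sum.inl l ∈ I ∧ Sum.inr l ∈ I := by
  simp only [Finset.subset_iff, Sum.forall, mem_hrDouble, Finset.mem_singleton, Sum.elim_inl,
    Sum.elim_inr, id, forall_eq]

theorem card_hrDouble : (hrDouble S).card = 2 * S.card := by
  rw [hrDouble, Finset.card_disjSum, two_mul]

theorem hrDouble_empty : hrDouble (∅ : Finset (Fin r)) = ∅ := rfl

theorem hrDouble_nonempty (hS : S.Nonempty) : (hrDouble S).Nonempty := by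
  obtain ⟨l, hl⟩ := hS
  exact ⟨Sum.inl l, mem_hrDouble.2 hl⟩

theorem hrDouble_singleton_subset_hrDouble (hl : l ∈ S) : hrDouble {l} ⊆ hrDouble S :=
  hrDouble_singleton_subset.2 ⟨mem_hrDouble.2 hl, mem_hrDouble.2 hl⟩

theorem hrDiag_rel {v w : DiagVertex r} : hrDiag S I v w ↔
    (if Sum.elim id id v ∈ S then (Sum.inl (v ∈ I) : Prop ⊕ Fin r)
      else Sum.inr (Sum.elim id id v)) =
    if Sum.elim id id w ∈ S then (Sum.inl (w ∈ I) : Prop ⊕ Fin r)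
      else Sum.inr (Sum.elim id id w) := Iff.rfl

theorem hrDiag_le_ker_iff {C : Type*} {g : DiagVertex r → C} (hI : I ⊆ hrDouble S) :
    hrDiag S I ≤ Setoid.ker g ↔ (∀ l, l ∉ S → g (Sum.inl l) = g (Sum.inr l)) ∧
      (∀ v ∈ I, ∀ w ∈ I, g v = g w) ∧
      ∀ v ∈ hrDouble S \ I, ∀ w ∈ hrDouble S \ I, g v = g w := by
  constructor
  · intro h
    refine ⟨fun l hl => ?_, fun v hv w hw => ?_, fun v hv w hw => ?_⟩
    · refine h (x := Sum.inl l) (y := Sum.inr l) ?_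
      simp [hrDiag_rel, hl]
    · refine h (x := v) (y := w) ?_
      simp [hrDiag_rel, hv, hw, mem_hrDouble.1 (hI hv), mem_hrDouble.1 (hI hw)]
    · rw [Finset.mem_sdiff, mem_hrDouble] at hv hw
      refine h (x := v) (y := w) ?_
      simp [hrDiag_rel, hv, hw]
  · rintro ⟨h1, h2, h3⟩ v w hvw
    simp only [Finset.mem_sdiff, mem_hrDouble] at h3
    rw [hrDiag_rel] at hvw
    rw [Setoid.ker_def]
    split_ifs at hvw with hv hw hw
    · have h4 : (v ∈ I) ↔ (w ∈ I) := iff_of_eq (Sum.inl.inj hvw)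
      by_cases h5 : v ∈ I
      · exact h2 v h5 w (h4.1 h5)
      · exact h3 v ⟨hv, h5⟩ w ⟨hw, fun h => h5 (h4.2 h)⟩
    · have h4 := Sum.inr.inj hvw
      have h5 := h1 _ hv
      rcases v with v | v <;> rcases w with w | w <;>
        simp only [Sum.elim_inl, Sum.elim_inr, id] at h4 h5 <;> subst h4 <;> simp [h5]

theorem hrDiag_sdiff : hrDiag S (hrDouble S \ I) = hrDiag S I := by
  ext v w
  simp only [hrDiag_rel, Finset.mem_sdiff, mem_hrDouble]
  by_cases hv : Sum.elim id id v ∈ S <;> by_cases hw : Sum.elim id id w ∈ S <;>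
    simp [hv, hw, not_iff_not]

/-- Once `{l, l'}` is a block of its own it is indistinguishable from a strand outside `S`. This is
how exceptional index sets turn into terms `b_T`. -/
theorem hrDiag_hrDouble_singleton (hl : l ∈ S) :
    hrDiag S (hrDouble {l}) = hrBlock (S.erase l) := by
  ext v w
  change hrDiag S (hrDouble {l}) v w ↔ hrDiag (S.erase l) ∅ v w
  simp only [hrDiag_rel, mem_hrDouble, Finset.mem_singleton,
    Finset.mem_erase, Finset.notMem_empty]
  generalize Sum.elim id id v = v
  generalize Sum.elim id id w = w
  by_cases hv : v ∈ S <;> by_cases hw : w ∈ S <;> by_cases hv' : v = l <;> by_cases hw' : w = l <;>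
    grind

theorem hrBlock_eq_diagId (hS : S.card ≤ 1) : hrBlock S = diagId r := by
  ext v w
  change hrDiag S ∅ v w ↔ Sum.elim id id v = Sum.elim id id w
  simp only [hrDiag_rel, Finset.notMem_empty]
  generalize Sum.elim id id v = v
  generalize Sum.elim id id w = w
  rw [Finset.card_le_one] at hS
  by_cases hv : v ∈ S <;> by_cases hw : w ∈ S <;> simp [hv, hw]
  · exact hS v hv w hw
  · rintro rfl
    exact hw hv
  · rintro rfl
    exact hv hw

theorem diag_hrBlock_eq_one {δ : ℂ} (hS : S.card ≤ 1) :
    (diag (hrBlock S) : PartAlg ℂ δ r) = 1 := by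
  rw [hrBlock_eq_diagId hS]
  rfl

theorem hrSign_sdiff (hI : I ⊆ hrDouble S) : hrSign S (hrDouble S \ I) = hrSign S I := by
  rw [hrSign, hrSign, Finset.sdiff_sdiff_eq_self hI, add_comm]

theorem prod_neg_one_ite {α : Type*} (s : Finset α) (P : α → Prop) [DecidablePred P] :
    ∏ i ∈ s, (if P i then (-1 : ℂ) else 1) = (-1) ^ (s.filter P).card := by
  rw [Finset.prod_ite, Finset.prod_const, Finset.prod_const_one, mul_one]

/-- Each `l ∈ S` contributes `-1` when `l` and `l'` lie on the same side and `1` when `I` separates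
them, which is `(-1) ^ (1 + j)` with `j` the number of vertices among `l`, `l'` outside `I`. In this
form the sign comes out of the expansion of a product over vertices. -/
theorem hrSign_eq :
    hrSign S I = (-1) ^ (S.card + (hrDouble S \ I).card) := by
  have h1 : (hrDouble S \ I).card = ((hrDouble S).filter (· ∉ I)).card := by
    rw [Finset.filter_notMem_eq_sdiff]
  rw [hrSign, pow_add, pow_add, h1, ← prod_neg_one_ite, ← prod_neg_one_ite, ← prod_neg_one_ite,
    ← Finset.prod_const, hrDouble, Finset.prod_disjSum, ← Finset.prod_mul_distrib,
    ← Finset.prod_mul_distrib, ← Finset.prod_mul_distrib]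
  refine Finset.prod_congr rfl fun l hl => ?_
  rw [← hrDouble]
  simp only [hrDouble_singleton_subset, Finset.mem_sdiff, mem_hrDouble, Sum.elim_inl,
    Sum.elim_inr, id, hl, true_and]
  by_cases h1 : Sum.inl l ∈ I <;> by_cases h2 : Sum.inr l ∈ I <;> simp [h1, h2]

theorem hrSign_hrDouble_singleton (hl : l ∈ S) : hrSign S (hrDouble {l}) = (-1) ^ S.card := by
  have hs := hrDouble_singleton_subset_hrDouble hl
  rw [hrSign_eq, Finset.card_sdiff_of_subset hs, card_hrDouble, card_hrDouble, ← Nat.mul_sub,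
    pow_add, pow_mul (-1 : ℂ) 2]
  simp

end diagrams

/-! ### Expansion of the action of the transpositions of colours -/

section indicator

open Classical in
/-- The truth value of a proposition as a complex number. -/
noncomputable def ind (p : Prop) : ℂ := if p then 1 else 0

theorem ind_of_true {p : Prop} (h : p) : ind p = 1 := if_pos h

theorem ind_of_false {p : Prop} (h : ¬p) : ind p = 0 := if_neg h

theorem ind_congr {p q : Prop} (h : p ↔ q) : ind p = ind q := congrArg ind (propext h)

theorem ind_mul_ind (p q : Prop) : ind p * ind q = ind (p ∧ q) := by
  by_cases hp : p <;> by_cases hq : q <;> simp [ind, hp, hq]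

theorem prod_ind {ι : Type*} (s : Finset ι) (p : ι → Prop) :
    ∏ i ∈ s, ind (p i) = ind (∀ i ∈ s, p i) := by
  by_cases h : ∀ i ∈ s, p i
  · rw [ind_of_true h, Finset.prod_eq_one fun i hi => ind_of_true (h i hi)]
  · rw [ind_of_false h]
    push Not at h
    obtain ⟨i, hi, hp⟩ := h
    exact Finset.prod_eq_zero hi (ind_of_false hp)

theorem sum_ind_eq_mul {ι : Type*} [Fintype ι] (a : ι) (f : ι → ℂ) :
    ∑ b, ind (a = b) * f b = f a := by
  rw [Finset.sum_eq_single a]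
  · rw [ind_of_true rfl, one_mul]
  · intro b _ hb
    rw [ind_of_false hb.symm, zero_mul]
  · simp

end indicator

section expansion

variable {N r : ℕ} (x y : Fin r → Fin N)

theorem mat_diag_eq_ind (d : PartDiagram r) :
    mat N r (diag d) x y = ind (d ≤ Setoid.ker (Sum.elim x y)) := by
  rw [mat_diag]
  rfl

/-- The indicator function of the pairs of words that agree outside `S`. -/
noncomputable def agreeOff (S : Finset (Fin r)) : ℂ := ∏ l ∈ Sᶜ, ind (x l = y l)

/-- The indicator function of the pairs of words in which all vertices in `J` have colour `b`. -/
noncomputable def monoIn (J : Finset (DiagVertex r)) (b : Fin N) : ℂ :=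
  ∏ v ∈ J, ind (Sum.elim x y v = b)

/-- The number of colours `b` such that all vertices in `J` have colour `b`. -/
noncomputable def monoCount (J : Finset (DiagVertex r)) : ℂ := ∑ b, monoIn x y J b

theorem monoCount_empty : monoCount x y ∅ = N := by
  simp [monoCount, monoIn]

theorem monoCount_of_nonempty {J : Finset (DiagVertex r)} (hJ : J.Nonempty) :
    monoCount x y J = ind (∀ v ∈ J, ∀ w ∈ J, Sum.elim x y v = Sum.elim x y w) := by
  obtain ⟨v, hv⟩ := hJ
  simp only [monoCount, monoIn, prod_ind]
  rw [Finset.sum_eq_single (Sum.elim x y v)]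
  · exact ind_congr ⟨fun h w hw w' hw' => (h w hw).trans (h w' hw').symm,
      fun h w hw => h w hw v hv⟩
  · exact fun b _ hb => ind_of_false fun h => hb (h v hv).symm
  · simp

theorem agreeOff_empty : agreeOff x y ∅ = ind (y = x) := by
  rw [agreeOff, prod_ind]
  refine ind_congr ⟨fun h => funext fun l => (h l (by simp)).symm, ?_⟩
  rintro rfl l _
  rfl

/-- Both parts must be nonempty: an empty set is monochromatic in all `N` colours, so `monoCount`
would contribute `N` instead of an indicator. This is the source of the coefficient `N` of `b_S`. -/
theorem mat_hrDiag {S : Finset (Fin r)} {I : Finset (DiagVertex r)} (hI : I ⊆ hrDouble S)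
    (h1 : I.Nonempty) (h2 : (hrDouble S \ I).Nonempty) :
    mat N r (diag (hrDiag S I)) x y =
      agreeOff x y S * (monoCount x y I * monoCount x y (hrDouble S \ I)) := by
  rw [mat_diag_eq_ind, monoCount_of_nonempty x y h1, monoCount_of_nonempty x y h2, agreeOff,
    prod_ind, ind_mul_ind, ind_mul_ind]
  refine ind_congr ((hrDiag_le_ker_iff hI).trans ?_)
  simp only [Finset.mem_compl, Sum.elim_inl, Sum.elim_inr]

theorem mat_hrBlock {S : Finset (Fin r)} (hS : S.Nonempty) :
    mat N r (diag (hrBlock S)) x y = agreeOff x y S * monoCount x y (hrDouble S) := by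
  rw [mat_diag_eq_ind, monoCount_of_nonempty x y (hrDouble_nonempty hS), agreeOff,
    prod_ind, ind_mul_ind]
  refine ind_congr ((hrDiag_le_ker_iff (Finset.empty_subset _)).trans ?_)
  simp

/-- The contribution of `S` to the transposition of the colours `b` and `c`. -/
noncomputable def swapTerm (S : Finset (Fin r)) (b c : Fin N) : ℂ :=
  agreeOff x y S * ∑ I ∈ (hrDouble S).powerset,
    hrSign S I * (monoIn x y I b * monoIn x y (hrDouble S \ I) c)

/-- Multiply out over the vertices of `S ∪ S'`: `I` collects the vertices at which the indicator of
`b` is chosen, each vertex outside `I` gives a sign, and `hrSign_eq` identifies the total sign. -/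
theorem prod_swap_factor (S : Finset (Fin r)) (b c : Fin N) :
    ∏ l ∈ S, -((ind (x l = b) - ind (x l = c)) * (ind (y l = b) - ind (y l = c))) =
    ∑ I ∈ (hrDouble S).powerset, hrSign S I * (monoIn x y I b * monoIn x y (hrDouble S \ I) c) := by
  have h1 : ∏ l ∈ S, -((ind (x l = b) - ind (x l = c)) * (ind (y l = b) - ind (y l = c))) =
      (-1) ^ S.card * ∏ v ∈ hrDouble S,
        (ind (Sum.elim x y v = b) + -ind (Sum.elim x y v = c)) := by
    rw [hrDouble, Finset.prod_disjSum, ← Finset.prod_mul_distrib, ← Finset.prod_const,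
      ← Finset.prod_mul_distrib]
    refine Finset.prod_congr rfl fun l _ => ?_
    simp only [Sum.elim_inl, Sum.elim_inr]
    ring
  rw [h1, Finset.prod_add, Finset.mul_sum]
  refine Finset.sum_congr rfl fun I _ => ?_
  rw [hrSign_eq, pow_add, monoIn, monoIn, Finset.prod_neg]
  ring

/-- On a single letter, the permutation matrix of the transposition `(b c)` is `1 - w wᵀ` with `w =
e_b - e_c`; the formula also covers `b = c`. -/
theorem ind_recolor_factor {C : Type*} [DecidableEq C] (a a' b c : C) :
    ind (a' = if a = b then c else if a = c then b else a) =
      -((ind (a = b) - ind (a = c)) * (ind (a' = b) - ind (a' = c))) + ind (a = a') := by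
  by_cases h3 : a = b <;> by_cases h4 : a = c <;> by_cases h5 : a' = b <;>
    by_cases h6 : a' = c <;> by_cases h7 : a = a' <;> simp only [ind] <;> grind

/-- The matrix is a tensor product over letters; `S` is the set of letters among the first `k` at
which the rank one summand is chosen in place of the identity. -/
theorem recolor_entry (k : ℕ) (b c : Fin N) :
    ind (y = recolor k b c x) =
      ∑ S ∈ (Finset.univ.filter fun v : Fin r => (v : ℕ) + 1 ≤ k).powerset,
        swapTerm x y S b c := by
  set K := Finset.univ.filter fun v : Fin r => (v : ℕ) + 1 ≤ k with hK
  have h1 : ind (y = recolor k b c x) =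
      (∏ l ∈ K, (-((ind (x l = b) - ind (x l = c)) * (ind (y l = b) - ind (y l = c))) +
        ind (x l = y l))) * ∏ l ∈ Kᶜ, ind (x l = y l) := by
    have h2 : ind (y = recolor k b c x) = ∏ l, ind (y l = recolor k b c x l) := by
      rw [prod_ind]
      exact ind_congr (funext_iff.trans (by simp))
    rw [h2, ← Finset.prod_mul_prod_compl K]
    congr 1
    · refine Finset.prod_congr rfl fun l hl => ?_
      have hl : (l : ℕ) < k := by simpa [hK] using hl
      rw [recolor, if_pos hl, ind_recolor_factor]
    · refine Finset.prod_congr rfl fun l hl => ?_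
      have hl : ¬ (l : ℕ) < k := by simpa [hK] using hl
      rw [recolor, if_neg hl]
      exact ind_congr eq_comm
  rw [h1, Finset.prod_add, Finset.sum_mul]
  refine Finset.sum_congr rfl fun S hS => ?_
  rw [Finset.mem_powerset] at hS
  rw [prod_swap_factor, swapTerm, mul_assoc, ← Finset.prod_union, mul_comm, agreeOff]
  · congr 2
    ext l
    simp only [Finset.mem_union, Finset.mem_sdiff, Finset.mem_compl]
    have := @hS l
    tauto
  · exact Finset.disjoint_left.2 fun l hl hl' =>
      (Finset.mem_compl.1 hl') (Finset.mem_sdiff.1 hl).1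

/-- The sum of all terms `½ · sign · d_I` for nonempty proper subsets `I` of `S ∪ S'`. -/
noncomputable def fullP (δ : ℂ) (S : Finset (Fin r)) : PartAlg ℂ δ r :=
  ∑ I ∈ (hrDouble S).powerset.filter (fun I => I ≠ ∅ ∧ I ≠ hrDouble S),
    ((1 / 2 : ℂ) * hrSign S I) • diag (hrDiag S I)

theorem hrSign_empty (S : Finset (Fin r)) : hrSign S ∅ = (-1) ^ S.card := by
  rw [hrSign_eq, Finset.sdiff_empty, card_hrDouble, pow_add, pow_mul]
  simp

theorem hrSign_hrDouble (S : Finset (Fin r)) : hrSign S (hrDouble S) = (-1) ^ S.card := by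
  rw [hrSign_eq, Finset.sdiff_self, Finset.card_empty, add_zero]

theorem sdiff_nonempty_of_ne {α : Type*} [DecidableEq α] {s t : Finset α} (h : s ⊆ t)
    (hne : s ≠ t) : (t \ s).Nonempty := by
  rw [Finset.sdiff_nonempty]
  exact fun h' => hne (h.antisymm h')

theorem mat_sum_apply {ι : Type*} (s : Finset ι) (F : ι → PartAlg ℂ (N : ℂ) r) :
    mat N r (∑ i ∈ s, F i) x y = ∑ i ∈ s, mat N r (F i) x y := by
  rw [map_sum, Matrix.sum_apply]

theorem mat_smul_apply (c : ℂ) (a : PartAlg ℂ (N : ℂ) r) :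
    mat N r (c • a) x y = c * mat N r a x y := by
  rw [map_smul, Matrix.smul_apply, smul_eq_mul]

theorem mat_add_apply (a b : PartAlg ℂ (N : ℂ) r) :
    mat N r (a + b) x y = mat N r a x y + mat N r b x y := by
  rw [map_add, Matrix.add_apply]

theorem mat_one_apply : mat N r 1 x y = ind (y = x) := by
  rw [mat_one]
  by_cases h : x = y
  · rw [h, Matrix.one_apply_eq, ind_of_true rfl]
  · rw [Matrix.one_apply_ne h, ind_of_false (Ne.symm h)]

theorem sum_swapTerm (S : Finset (Fin r)) :
    ∑ b, ∑ c, swapTerm x y S b c = agreeOff x y S * ∑ I ∈ (hrDouble S).powerset,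
      hrSign S I * (monoCount x y I * monoCount x y (hrDouble S \ I)) := by
  have h : ∀ b, ∑ c, swapTerm x y S b c = agreeOff x y S * ∑ I ∈ (hrDouble S).powerset,
      hrSign S I * (monoIn x y I b * monoCount x y (hrDouble S \ I)) := by
    intro b
    simp only [swapTerm]
    rw [← Finset.mul_sum, Finset.sum_comm]
    simp only [← Finset.mul_sum]
    rfl
  simp only [h]
  rw [← Finset.mul_sum, Finset.sum_comm]
  simp only [← Finset.mul_sum, ← Finset.sum_mul]
  rfl

theorem sum_swapTerm_empty : ∑ b, ∑ c, swapTerm x y ∅ b c = N ^ 2 * mat N r 1 x y := by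
  rw [sum_swapTerm, mat_one_apply, agreeOff_empty, hrDouble_empty, Finset.powerset_empty,
    Finset.sum_singleton, hrSign_empty, Finset.sdiff_empty, monoCount_empty, Finset.card_empty]
  ring

/-- The sets `I = ∅` and `I = S ∪ S'` each contribute `N` times the block diagram; every other `I`
gives `d_I`. The factor 2 undoes the `1 / 2` in `fullP`. -/
theorem sum_swapTerm_of_nonempty {S : Finset (Fin r)} (hS : S.Nonempty) :
    ∑ b, ∑ c, swapTerm x y S b c =
      2 * mat N r (fullP N S + ((N : ℂ) * (-1) ^ S.card) • diag (hrBlock S)) x y := by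
  have hne : (∅ : Finset (DiagVertex r)) ≠ hrDouble S := (hrDouble_nonempty hS).ne_empty.symm
  have h1 : (hrDouble S).powerset.filter (fun I => ¬ (I ≠ ∅ ∧ I ≠ hrDouble S)) =
      {∅, hrDouble S} := by
    ext I
    simp only [Finset.mem_filter, Finset.mem_powerset, Finset.mem_insert, Finset.mem_singleton]
    constructor
    · rintro ⟨-, h⟩
      tauto
    · rintro (rfl | rfl) <;> simp
  have h2 : mat N r (fullP N S) x y =
      ∑ I ∈ (hrDouble S).powerset.filter (fun I => I ≠ ∅ ∧ I ≠ hrDouble S),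
      (1 / 2) * (agreeOff x y S *
        (hrSign S I * (monoCount x y I * monoCount x y (hrDouble S \ I)))) := by
    rw [fullP, mat_sum_apply]
    refine Finset.sum_congr rfl fun I hI => ?_
    obtain ⟨hI, hI', hI''⟩ := Finset.mem_filter.1 hI
    rw [Finset.mem_powerset] at hI
    rw [mat_smul_apply, mat_hrDiag x y hI (Finset.nonempty_of_ne_empty hI')
      (sdiff_nonempty_of_ne hI hI'')]
    ring
  rw [sum_swapTerm, ← Finset.sum_filter_add_sum_filter_not _ (fun I => I ≠ ∅ ∧ I ≠ hrDouble S), h1,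
    Finset.sum_pair hne, hrSign_empty, hrSign_hrDouble, Finset.sdiff_self, Finset.sdiff_empty,
    monoCount_empty, mat_add_apply, mat_smul_apply, mat_hrBlock x y hS, h2, ← Finset.mul_sum,
    ← Finset.mul_sum]
  ring

end expansion

-- The sum over transpositions that move the colour of the last letter

section half

variable {N k r : ℕ}

theorem hrDouble_insert (m : Fin r) (S : Finset (Fin r)) :
    hrDouble (insert m S) = hrDouble S ∪ hrDouble {m} := by
  ext v
  simp only [Finset.mem_union, mem_hrDouble, Finset.mem_insert, Finset.mem_singleton]
  tauto

theorem disjoint_hrDouble {S T : Finset (Fin r)} (h : Disjoint S T) :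
    Disjoint (hrDouble S) (hrDouble T) := by
  rw [Finset.disjoint_left] at h ⊢
  intro v hv hv'
  rw [mem_hrDouble] at hv hv'
  exact h hv hv'

variable (x y : Fin r → Fin N)

theorem monoIn_union_singleton {m : Fin r} {I : Finset (DiagVertex r)}
    (h : Disjoint I (hrDouble {m})) (b : Fin N) :
    monoIn x y (I ∪ hrDouble {m}) b = monoIn x y I b * (ind (x m = b) * ind (y m = b)) := by
  rw [monoIn, Finset.prod_union h, ← monoIn, hrDouble, Finset.prod_disjSum,
    Finset.prod_singleton, Finset.prod_singleton]
  rfl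

theorem ind_mul_agreeOff {m : Fin r} {S : Finset (Fin r)} (hm : m ∉ S) (b : Fin N) :
    ind (x m = b) * agreeOff x y S =
      agreeOff x y (insert m S) * (ind (x m = b) * ind (y m = b)) := by
  have h1 : Sᶜ = insert m (insert m S)ᶜ := by
    ext l
    simp only [Finset.mem_compl, Finset.mem_insert]
    by_cases hl : l = m
    · simp [hl, hm]
    · simp [hl]
  rw [agreeOff, h1, Finset.prod_insert (by simp), ← agreeOff, ← mul_assoc, ind_mul_ind,
    ind_mul_ind, mul_comm]
  congr 1
  refine ind_congr ⟨fun h => ⟨h.1, h.2 ▸ h.1⟩, fun h => ⟨h.1, h.1.trans h.2.symm⟩⟩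

/-- As `m ∉ S`, the two words agree at `m`, so the condition `x m = b` colours both `m` and `m'` by
`b`. They can be absorbed into `I`, which replaces `S` by `insert m S` and reverses the sign: one
more pair lies on a single side. -/
theorem sum_ind_mul_swapTerm {m : Fin r} {S : Finset (Fin r)} (hm : m ∉ S) :
    ∑ b, ind (x m = b) * ∑ c, swapTerm x y S b c =
      -(agreeOff x y (insert m S) *
        ∑ I ∈ (hrDouble (insert m S)).powerset.filter (fun I => hrDouble {m} ⊆ I),
          hrSign (insert m S) I * (monoCount x y I * monoCount x y (hrDouble (insert m S) \ I))) := by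
  have hd : Disjoint (hrDouble S) (hrDouble {m}) :=
    disjoint_hrDouble (Finset.disjoint_singleton_right.2 hm)
  have h1 : ∀ b, ind (x m = b) * ∑ c, swapTerm x y S b c =
      agreeOff x y (insert m S) * ∑ I ∈ (hrDouble S).powerset,
        hrSign S I * (monoIn x y (I ∪ hrDouble {m}) b * monoCount x y (hrDouble S \ I)) := by
    intro b
    simp only [swapTerm]
    rw [← Finset.mul_sum, Finset.sum_comm, ← mul_assoc, ind_mul_agreeOff x y hm, mul_assoc,
      Finset.mul_sum]
    congr 1
    refine Finset.sum_congr rfl fun I hI => ?_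
    rw [Finset.mem_powerset] at hI
    rw [monoIn_union_singleton x y (hd.mono_left hI), ← Finset.mul_sum, ← Finset.mul_sum,
      ← monoCount]
    ring
  simp only [h1]
  rw [← Finset.mul_sum, ← mul_neg, Finset.sum_comm, ← Finset.sum_neg_distrib]
  congr 1
  have hsub : ∀ I ⊆ hrDouble S,
      hrDouble (insert m S) \ (I ∪ hrDouble {m}) = hrDouble S \ I := by
    intro I hI
    rw [hrDouble_insert]
    ext v
    have h2 : v ∈ hrDouble S → v ∉ hrDouble {m} := fun h => Finset.disjoint_left.1 hd h
    have h3 : v ∈ I → v ∈ hrDouble S := fun h => hI h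
    simp only [Finset.mem_sdiff, Finset.mem_union]
    tauto
  refine Finset.sum_nbij' (fun I => I ∪ hrDouble {m}) (fun I => I \ hrDouble {m}) ?_ ?_ ?_ ?_ ?_
  · intro I hI
    rw [Finset.mem_powerset] at hI
    rw [Finset.mem_filter, Finset.mem_powerset, hrDouble_insert]
    exact ⟨Finset.union_subset_union_left hI, Finset.subset_union_right⟩
  · intro I hI
    rw [Finset.mem_filter, Finset.mem_powerset, hrDouble_insert] at hI
    rw [Finset.mem_powerset]
    intro v hv
    rw [Finset.mem_sdiff] at hv
    exact (Finset.mem_union.1 (hI.1 hv.1)).resolve_right hv.2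
  · intro I hI
    rw [Finset.mem_powerset] at hI
    rw [Finset.union_sdiff_right, Finset.sdiff_eq_self_of_disjoint (hd.mono_left hI)]
  · intro I hI
    exact Finset.sdiff_union_of_subset (Finset.mem_filter.1 hI).2
  · intro I hI
    rw [Finset.mem_powerset] at hI
    simp only [hsub I hI, hrSign_eq, Finset.card_insert_of_notMem hm]
    rw [← Finset.mul_sum, ← Finset.sum_mul, monoCount.eq_def x y (I ∪ hrDouble {m})]
    ring

/-- The sum of all terms `sign · d_I` for proper subsets `I` of `S ∪ S'` that contain `m`
and `m'`. -/
noncomputable def fixedP (δ : ℂ) (m : Fin r) (S : Finset (Fin r)) : PartAlg ℂ δ r :=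
  ∑ I ∈ (hrDouble S).powerset.filter (fun I => hrDouble {m} ⊆ I ∧ I ≠ hrDouble S),
    hrSign S I • diag (hrDiag S I)

theorem mat_fixedP {m : Fin r} {S : Finset (Fin r)} (hm : m ∈ S) :
    agreeOff x y S * ∑ I ∈ (hrDouble S).powerset.filter (fun I => hrDouble {m} ⊆ I),
        hrSign S I * (monoCount x y I * monoCount x y (hrDouble S \ I)) =
      mat N r (fixedP N m S + ((N : ℂ) * (-1) ^ S.card) • diag (hrBlock S)) x y := by
  have h1 : ((hrDouble S).powerset.filter (fun I => hrDouble {m} ⊆ I)).filter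
      (fun I => ¬ I ≠ hrDouble S) = {hrDouble S} := by
    ext I
    simp only [Finset.mem_filter, Finset.mem_powerset, Finset.mem_singleton, not_not]
    constructor
    · exact fun h => h.2
    · rintro rfl
      exact ⟨⟨subset_rfl, hrDouble_singleton_subset_hrDouble hm⟩, rfl⟩
  have h2 : mat N r (fixedP N m S) x y =
      ∑ I ∈ (hrDouble S).powerset.filter (fun I => hrDouble {m} ⊆ I ∧ I ≠ hrDouble S),
      agreeOff x y S * (hrSign S I * (monoCount x y I * monoCount x y (hrDouble S \ I))) := by
    rw [fixedP, mat_sum_apply]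
    refine Finset.sum_congr rfl fun I hI => ?_
    obtain ⟨hI, hI', hI''⟩ := Finset.mem_filter.1 hI
    rw [Finset.mem_powerset] at hI
    rw [mat_smul_apply, mat_hrDiag x y hI
      ((hrDouble_nonempty (Finset.singleton_nonempty m)).mono hI') (sdiff_nonempty_of_ne hI hI'')]
    ring
  rw [← Finset.sum_filter_add_sum_filter_not _ (fun I => I ≠ hrDouble S), h1,
    Finset.filter_filter, Finset.sum_singleton, hrSign_hrDouble, Finset.sdiff_self,
    monoCount_empty, mat_add_apply, mat_smul_apply, mat_hrBlock x y ⟨m, hm⟩, h2, ← Finset.mul_sum]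
  ring

theorem sum_insert_last {M : Type*} [AddCommMonoid M] (G : Finset (Fin (k + 1)) → M) :
    ∑ S ∈ (Finset.univ.filter fun v : Fin (k + 1) => (v : ℕ) + 1 ≤ k).powerset,
        G (insert (Fin.last k) S) =
      ∑ S ∈ (Finset.univ : Finset (Fin (k + 1))).powerset.filter (fun S => Fin.last k ∈ S),
        G S := by
  have hlast : ∀ S ⊆ Finset.univ.filter fun v : Fin (k + 1) => (v : ℕ) + 1 ≤ k,
      Fin.last k ∉ S := by
    intro S hS h
    have := (Finset.mem_filter.1 (hS h)).2
    simp at this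
  refine Finset.sum_nbij' (fun S => insert (Fin.last k) S) (fun S => S.erase (Fin.last k))
    ?_ ?_ ?_ ?_ ?_
  · intro S _
    simp
  · intro S _
    rw [Finset.mem_powerset]
    intro v hv
    have h1 := Fin.val_ne_of_ne (Finset.ne_of_mem_erase hv)
    rw [Fin.val_last] at h1
    rw [Finset.mem_filter]
    exact ⟨Finset.mem_univ _, by omega⟩
  · intro S hS
    exact Finset.erase_insert (hlast S (Finset.mem_powerset.1 hS))
  · intro S hS
    exact Finset.insert_erase (Finset.mem_filter.1 hS).2
  · intro S _
    rfl

theorem sum_recolor_last (x y : Fin (k + 1) → Fin N) :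
    ∑ c, ind (y = recolor k (x (Fin.last k)) c x) =
      -∑ S ∈ (Finset.univ : Finset (Fin (k + 1))).powerset.filter (fun S => Fin.last k ∈ S),
        mat N (k + 1) (fixedP N (Fin.last k) S +
          ((N : ℂ) * (-1) ^ S.card) • diag (hrBlock S)) x y := by
  -- The colour `x (Fin.last k)` varies with the word; making it a summation variable `b` with an
  -- indicator brings the expansion for fixed `b`, `c` into play.
  rw [← sum_ind_eq_mul (x (Fin.last k)) (fun b => ∑ c, ind (y = recolor k b c x)),
    ← sum_insert_last, ← Finset.sum_neg_distrib]
  have h1 : ∀ b, ind (x (Fin.last k) = b) * ∑ c, ind (y = recolor k b c x) =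
      ∑ S ∈ (Finset.univ.filter fun v : Fin (k + 1) => (v : ℕ) + 1 ≤ k).powerset,
        ind (x (Fin.last k) = b) * ∑ c, swapTerm x y S b c := by
    intro b
    simp only [recolor_entry]
    rw [Finset.sum_comm, Finset.mul_sum]
  simp only [h1]
  rw [Finset.sum_comm]
  refine Finset.sum_congr rfl fun S hS => ?_
  have hm : Fin.last k ∉ S := fun h => by
    have := (Finset.mem_filter.1 (Finset.mem_powerset.1 hS h)).2
    simp at this
  rw [sum_ind_mul_swapTerm x y hm, mat_fixedP x y (Finset.mem_insert_self _ _)]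

end half

/-! ### Collecting the exceptional terms -/

section collect

/-- Each `T` arises from `S = insert l T` for the `|K| - |T|` elements `l` of `K \ T`. This
multiplicity is what shifts the coefficients of `b_T`. -/
theorem sum_powerset_sum_erase {ι M : Type*} [DecidableEq ι] [AddCommGroup M] [Module ℂ M]
    (K : Finset ι) (F : Finset ι → M) :
    ∑ S ∈ K.powerset, ∑ l ∈ S, F (S.erase l) =
      ∑ T ∈ K.powerset, ((K.card : ℂ) - T.card) • F T := by
  have h1 : ∀ T ∈ K.powerset, ((K.card : ℂ) - T.card) • F T = ∑ _l ∈ K \ T, F T := by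
    intro T hT
    rw [Finset.mem_powerset] at hT
    rw [Finset.sum_const, Finset.card_sdiff_of_subset hT, ← Nat.cast_smul_eq_nsmul ℂ,
      Nat.cast_sub (Finset.card_le_card hT)]
  rw [Finset.sum_congr rfl h1, Finset.sum_sigma', Finset.sum_sigma']
  refine Finset.sum_nbij' (fun a => ⟨a.1.erase a.2, a.2⟩) (fun a => ⟨insert a.2 a.1, a.2⟩)
    ?_ ?_ ?_ ?_ ?_
  · rintro ⟨S, l⟩ h
    simp only [Finset.mem_sigma, Finset.mem_powerset, Finset.mem_sdiff] at h ⊢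
    exact ⟨(Finset.erase_subset _ _).trans h.1, h.1 h.2, Finset.notMem_erase _ _⟩
  · rintro ⟨T, l⟩ h
    simp only [Finset.mem_sigma, Finset.mem_powerset, Finset.mem_sdiff] at h ⊢
    exact ⟨Finset.insert_subset h.2.1 h.1, Finset.mem_insert_self _ _⟩
  · rintro ⟨S, l⟩ h
    simp only [Finset.mem_sigma] at h
    simp only [Finset.insert_erase h.2]
  · rintro ⟨T, l⟩ h
    simp only [Finset.mem_sigma, Finset.mem_sdiff] at h
    simp only [Finset.erase_insert h.2.2]
  · rintro ⟨S, l⟩ h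
    rfl

variable {r : ℕ} {δ : ℂ}

theorem hrDouble_singleton_injective : Function.Injective fun l : Fin r => hrDouble {l} := by
  intro l l' h
  have h1 : (Sum.inl l : DiagVertex r) ∈ hrDouble {l} := mem_hrDouble.2 (by simp)
  change hrDouble {l} = hrDouble {l'} at h
  rw [h] at h1
  simpa [mem_hrDouble] using h1

theorem hrDouble_sdiff (S T : Finset (Fin r)) :
    hrDouble S \ hrDouble T = hrDouble (S \ T) := by
  ext v
  simp only [Finset.mem_sdiff, mem_hrDouble]

theorem hrDouble_injective : Function.Injective (hrDouble (r := r)) := by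
  intro S T h
  ext l
  have h1 := congrArg (fun I => Sum.inl l ∈ I) h
  simpa [mem_hrDouble] using h1

/-- The terms produced by the exceptional index sets. -/
noncomputable def excTerm (δ : ℂ) (T : Finset (Fin r)) : PartAlg ℂ δ r :=
  if 2 ≤ T.card then ((-1 : ℂ) ^ (T.card + 1)) • diag (hrBlock T) else 0

theorem exceptional_eq {S : Finset (Fin r)} (hS : 2 ≤ S.card) :
    ((hrDouble S).powerset.filter (fun I => I ≠ ∅ ∧ I ≠ hrDouble S)).filter
      (fun I => ¬ ∀ l ∈ S, I ≠ hrDouble {l} ∧ I ≠ hrDouble S \ hrDouble {l}) =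
    S.image (fun l => hrDouble {l}) ∪ S.image (fun l => hrDouble S \ hrDouble {l}) := by
  ext I
  simp only [Finset.mem_filter, Finset.mem_powerset, Finset.mem_union, Finset.mem_image]
  push Not
  constructor
  · rintro ⟨-, l, hl, h⟩
    by_cases h1 : I = hrDouble {l}
    · exact Or.inl ⟨l, hl, h1.symm⟩
    · exact Or.inr ⟨l, hl, (h h1).symm⟩
  · have hlt : ∀ l ∈ S, hrDouble {l} ≠ hrDouble S := fun l _ h => by
      rw [← hrDouble_injective h, Finset.card_singleton] at hS
      omega
    have hne : ∀ l, hrDouble ({l} : Finset (Fin r)) ≠ ∅ := fun l =>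
      (hrDouble_nonempty (Finset.singleton_nonempty l)).ne_empty
    rintro (⟨l, hl, rfl⟩ | ⟨l, hl, rfl⟩)
    · exact ⟨⟨hrDouble_singleton_subset_hrDouble hl,
        Finset.nonempty_iff_ne_empty.2 (hne l), hlt l hl⟩, l, hl, fun h => absurd rfl h⟩
    · refine ⟨⟨Finset.sdiff_subset, ?_, ?_⟩, l, hl, fun _ => rfl⟩
      · exact sdiff_nonempty_of_ne (hrDouble_singleton_subset_hrDouble hl) (hlt l hl)
      · intro h
        obtain ⟨v, hv⟩ := Finset.nonempty_iff_ne_empty.2 (hne l)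
        have h1 := hrDouble_singleton_subset_hrDouble hl hv
        rw [← h, Finset.mem_sdiff] at h1
        exact h1.2 hv

/-- For `|S| ≤ 1` every exceptional set is already excluded. For `|S| = 2` the sets `{ℓ, ℓ'}` and
their complements coincide, and the two of them give half the identity each. For `|S| ≥ 3` they are
all distinct, and each complementary pair gives a full term `b_{S \ ℓ}`. -/
theorem sum_exceptional (S : Finset (Fin r)) :
    ∑ I ∈ ((hrDouble S).powerset.filter (fun I => I ≠ ∅ ∧ I ≠ hrDouble S)).filter
      (fun I => ¬ ∀ l ∈ S, I ≠ hrDouble {l} ∧ I ≠ hrDouble S \ hrDouble {l}),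
      ((1 / 2 : ℂ) * hrSign S I) • (diag (hrDiag S I) : PartAlg ℂ δ r) =
    (if S.card = 2 then 1 else 0) + ∑ l ∈ S, excTerm δ (S.erase l) := by
  have hA : ∑ I ∈ S.image (fun l => hrDouble {l}),
      ((1 / 2 : ℂ) * hrSign S I) • (diag (hrDiag S I) : PartAlg ℂ δ r) =
      ∑ l ∈ S, ((1 / 2 : ℂ) * (-1) ^ S.card) • diag (hrBlock (S.erase l)) := by
    rw [Finset.sum_image hrDouble_singleton_injective.injOn]
    refine Finset.sum_congr rfl fun l hl => ?_
    rw [hrSign_hrDouble_singleton hl, hrDiag_hrDouble_singleton hl]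
  have hB : ∑ I ∈ S.image (fun l => hrDouble S \ hrDouble {l}),
      ((1 / 2 : ℂ) * hrSign S I) • (diag (hrDiag S I) : PartAlg ℂ δ r) =
      ∑ l ∈ S, ((1 / 2 : ℂ) * (-1) ^ S.card) • diag (hrBlock (S.erase l)) := by
    rw [Finset.sum_image]
    · refine Finset.sum_congr rfl fun l hl => ?_
      rw [hrSign_sdiff (hrDouble_singleton_subset_hrDouble hl), hrSign_hrDouble_singleton hl,
        hrDiag_sdiff, hrDiag_hrDouble_singleton hl]
    · intro l hl l' hl' h
      have h1 := congrArg (hrDouble S \ ·) h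
      simp only [Finset.sdiff_sdiff_eq_self (hrDouble_singleton_subset_hrDouble hl),
        Finset.sdiff_sdiff_eq_self (hrDouble_singleton_subset_hrDouble hl')] at h1
      exact hrDouble_singleton_injective h1
  rcases lt_trichotomy S.card 2 with hS | hS | hS
  · have h0 : ((hrDouble S).powerset.filter (fun I => I ≠ ∅ ∧ I ≠ hrDouble S)).filter
        (fun I => ¬ ∀ l ∈ S, I ≠ hrDouble {l} ∧ I ≠ hrDouble S \ hrDouble {l}) = ∅ := by
      rw [Finset.filter_eq_empty_iff]
      intro I hI
      obtain ⟨-, h1, h2⟩ := Finset.mem_filter.1 hI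
      rw [not_not]
      intro l hl
      have hSl : S = {l} := Finset.eq_singleton_iff_unique_mem.2
        ⟨hl, fun l' hl' => Finset.card_le_one.1 (by omega) l' hl' l hl⟩
      rw [← hSl, Finset.sdiff_self]
      exact ⟨h2, h1⟩
    rw [h0, Finset.sum_empty, if_neg (by omega), zero_add, Finset.sum_eq_zero]
    intro l hl
    rw [excTerm, if_neg]
    have := Finset.card_erase_le (s := S) (a := l)
    omega
  · obtain ⟨a, b, hab, rfl⟩ := Finset.card_eq_two.1 hS
    have h0 : ({a, b} : Finset (Fin r)).image
        (fun l => hrDouble {a, b} \ hrDouble {l}) = ({a, b} : Finset (Fin r)).image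
          (fun l => hrDouble {l}) := by
      have h1 : ({a, b} : Finset (Fin r)) \ {a} = {b} := by grind
      have h2 : ({a, b} : Finset (Fin r)) \ {b} = {a} := by grind
      simp only [hrDouble_sdiff, Finset.image_insert, Finset.image_singleton, h1, h2]
      exact Finset.pair_comm _ _
    rw [exceptional_eq hS.ge, h0, Finset.union_self, hA, if_pos hS, hS]
    have h1 : ∀ l ∈ ({a, b} : Finset (Fin r)), (({a, b} : Finset (Fin r)).erase l).card = 1 :=
      fun l hl => by rw [Finset.card_erase_of_mem hl, hS]
    rw [Finset.sum_congr (g := fun _ => (1 / 2 : ℂ) • (1 : PartAlg ℂ δ r)) rfl fun l hl => by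
        rw [diag_hrBlock_eq_one (h1 l hl).le]; norm_num,
      Finset.sum_congr (g := fun _ => (0 : PartAlg ℂ δ r)) (f := fun l => excTerm δ _) rfl
        fun l hl => by rw [excTerm, if_neg (by rw [h1 l hl]; omega)],
      Finset.sum_const, hS, Finset.sum_const_zero, add_zero, ← Nat.cast_smul_eq_nsmul ℂ, smul_smul]
    norm_num
  · rw [exceptional_eq hS.le, Finset.sum_union, hA, hB, if_neg hS.ne', zero_add,
      ← Finset.sum_add_distrib]
    · refine Finset.sum_congr rfl fun l hl => ?_
      rw [excTerm, Finset.card_erase_of_mem hl, if_pos (by omega), ← add_smul,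
        Nat.sub_add_cancel (by omega)]
      congr 1
      ring
    · rw [Finset.disjoint_left]
      intro I h1 h2
      obtain ⟨l, hl, rfl⟩ := Finset.mem_image.1 h1
      obtain ⟨l', hl', h⟩ := Finset.mem_image.1 h2
      rw [hrDouble_sdiff] at h
      have h3 := congrArg Finset.card (hrDouble_injective h)
      rw [Finset.card_sdiff_of_subset (Finset.singleton_subset_iff.2 hl'), Finset.card_singleton,
        Finset.card_singleton] at h3
      omega

theorem fullP_eq (S : Finset (Fin r)) :
    fullP δ S = hrP δ S + ((if S.card = 2 then 1 else 0) + ∑ l ∈ S, excTerm δ (S.erase l)) := by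
  rw [fullP, ← Finset.sum_filter_add_sum_filter_not _
    (fun I => ∀ l ∈ S, I ≠ hrDouble {l} ∧ I ≠ hrDouble S \ hrDouble {l}), sum_exceptional,
    Finset.filter_filter, hrP]
  simp only [and_assoc]

/-- Restoring the exceptional index sets simplifies every coefficient: pairs `S` use up the constant
`k.choose 2`, and `b_T` with `|T| ≥ 2` absorbs `k - |T|` exceptional terms, so that `δ - k + |T|`
becomes `δ`. The scalar `k * δ` compensates the `k` singletons now included, for which `b_S` is the
identity. -/
theorem hrZ_eq {k : ℕ} (hk : k ≤ r) :
    hrZ δ r k = (k * δ) • 1 +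
      ∑ S ∈ (Finset.univ.filter fun v : Fin r => (v : ℕ) + 1 ≤ k).powerset.filter
        (fun S => 1 ≤ S.card), (fullP δ S + (δ * (-1) ^ S.card) • diag (hrBlock S)) := by
  set K := Finset.univ.filter fun v : Fin r => (v : ℕ) + 1 ≤ k with hK
  have hcard : K.card = k := by
    have h : K = Finset.univ.filter fun v : Fin r => (v : ℕ) < k := by
      rw [hK]
      exact Finset.filter_congr fun v _ => Nat.succ_le_iff
    rw [h, Fin.card_filter_val_lt]
    omega
  have h1 : ∑ S ∈ K.powerset, (if 1 ≤ S.card then fullP δ S else 0) =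
      ∑ S ∈ K.powerset, (if 1 ≤ S.card then hrP δ S else 0) +
      ((k.choose 2 : ℕ) : ℂ) • 1 + ∑ T ∈ K.powerset, ((k : ℂ) - T.card) • excTerm δ T := by
    have h2 : ((k.choose 2 : ℕ) : ℂ) • (1 : PartAlg ℂ δ r) =
        ∑ S ∈ K.powerset, if S.card = 2 then 1 else 0 := by
      rw [← Finset.sum_filter, ← Finset.powersetCard_eq_filter, Finset.sum_const,
        Finset.card_powersetCard, hcard, Nat.cast_smul_eq_nsmul]
    have h3 := sum_powerset_sum_erase K (excTerm δ)
    rw [hcard] at h3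
    rw [← h3, h2, ← Finset.sum_add_distrib, ← Finset.sum_add_distrib]
    refine Finset.sum_congr rfl fun S _ => ?_
    split_ifs with h4 h5 h5
    · rw [fullP_eq, if_pos h5, add_assoc]
    · rw [fullP_eq, if_neg h5, add_assoc]
    · omega
    · have h6 : S = ∅ := Finset.card_eq_zero.1 (by omega)
      rw [h6]
      simp
  have h2 : ∑ S ∈ K.powerset, (if S.card = 1 then (-δ) • (1 : PartAlg ℂ δ r) else 0) =
      (-(k * δ)) • 1 := by
    rw [← Finset.sum_filter, ← Finset.powersetCard_eq_filter, Finset.sum_const,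
      Finset.card_powersetCard, hcard, ← Nat.cast_smul_eq_nsmul ℂ, smul_smul, Nat.choose_one_right]
    congr 1
    ring
  have h3 : ∑ S ∈ K.powerset, (if 1 ≤ S.card then (δ * (-1) ^ S.card) • diag (hrBlock S) else 0) +
      ∑ S ∈ K.powerset, ((k : ℂ) - S.card) • excTerm δ S =
      ∑ S ∈ K.powerset, (if 2 ≤ S.card then
        ((δ - k + S.card) * (-1) ^ S.card) • (diag (hrBlock S) : PartAlg ℂ δ r) else 0) +
      (-(k * δ)) • 1 := by
    rw [← h2, ← Finset.sum_add_distrib, ← Finset.sum_add_distrib]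
    refine Finset.sum_congr rfl fun S _ => ?_
    rw [excTerm]
    by_cases h4 : 2 ≤ S.card
    · rw [if_pos (by omega), if_pos h4, if_pos h4, if_neg (by omega), smul_smul, ← add_smul,
        add_zero]
      congr 1
      ring
    · rw [if_neg h4, if_neg h4, smul_zero]
      by_cases h5 : S.card = 1
      · rw [if_pos h5.ge, if_pos h5, diag_hrBlock_eq_one h5.le, h5, pow_one, mul_neg_one, add_zero,
          zero_add]
      · rw [if_neg (by omega), if_neg h5]
  rw [hrZ, ← hK, Finset.sum_add_distrib]
  simp only [Finset.sum_filter]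
  rw [h1]
  rw [add_assoc _ (∑ S ∈ K.powerset, ((k : ℂ) - S.card) • excTerm δ S), add_comm (∑ S ∈ K.powerset,
    ((k : ℂ) - S.card) • excTerm δ S), h3, neg_smul]
  abel

end collect

-- The exceptional terms of `M_{k+1/2}`

section collectHalf

variable {r : ℕ} {δ : ℂ}

/-- The conditions on the index sets in `p̃_S`, for those index sets that contain `m` and `m'`. -/
def TildeCond (m : Fin r) (S : Finset (Fin r)) (I : Finset (DiagVertex r)) : Prop :=
  ∀ l ∈ S, l ≠ m → I ≠ hrDouble S \ hrDouble {l}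

instance (m : Fin r) (S : Finset (Fin r)) : DecidablePred (TildeCond m S) :=
  fun _ => by unfold TildeCond; infer_instance

/-- Of the sets `I` and `I^c`, exactly one contains `m` and `m'`, and both give the same signed
diagram, so the factor `1 / 2` disappears. For an `I` containing `m` the conditions `I ≠ ∅` and `I ≠
{ℓ, ℓ'}` with `ℓ ≠ m` are automatic. -/
theorem hrPTilde_eq {m : Fin r} {S : Finset (Fin r)} (hm : m ∈ S) :
    hrPTilde δ m S = ∑ I ∈ ((hrDouble S).powerset.filter
      (fun I => hrDouble {m} ⊆ I ∧ I ≠ hrDouble S)).filter (TildeCond m S),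
      hrSign S I • diag (hrDiag S I) := by
  have hmd : Sum.inl m ∈ hrDouble ({m} : Finset (Fin r)) := mem_hrDouble.2 (by simp)
  have hmS : Sum.inl m ∈ hrDouble S := mem_hrDouble.2 hm
  have hnl : ∀ l, l ≠ m → Sum.inl m ∉ hrDouble ({l} : Finset (Fin r)) := fun l hl h => by
    rw [mem_hrDouble, Finset.mem_singleton] at h
    exact hl h.symm
  set G := ((hrDouble S).powerset.filter
    (fun I => hrDouble {m} ⊆ I ∧ I ≠ hrDouble S)).filter (TildeCond m S) with hG
  have hmem : ∀ I, I ∈ G ↔ I ⊆ hrDouble S ∧ hrDouble {m} ⊆ I ∧ I ≠ hrDouble S ∧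
      TildeCond m S I := by
    intro I
    rw [hG, Finset.mem_filter, Finset.mem_filter, Finset.mem_powerset]
    tauto
  rw [hrPTilde, ← Finset.sum_filter_add_sum_filter_not _ (fun I => hrDouble {m} ⊆ I)]
  have h1 : ((hrDouble S).powerset.filter (fun I =>
      (hrDouble {m} ⊆ I ∨ hrDouble {m} ⊆ hrDouble S \ I) ∧ I ≠ ∅ ∧ I ≠ hrDouble S ∧
      ∀ l ∈ S, l ≠ m → I ≠ hrDouble {l} ∧ I ≠ hrDouble S \ hrDouble {l})).filter
      (fun I => hrDouble {m} ⊆ I) = G := by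
    ext I
    rw [hmem, Finset.mem_filter, Finset.mem_filter, Finset.mem_powerset]
    constructor
    · rintro ⟨⟨h1, -, -, h2, h3⟩, h4⟩
      exact ⟨h1, h4, h2, fun l hl hlm => (h3 l hl hlm).2⟩
    · rintro ⟨h1, h2, h3, h4⟩
      refine ⟨⟨h1, Or.inl h2, ?_, h3, fun l hl hlm => ⟨?_, h4 l hl hlm⟩⟩, h2⟩
      · rintro rfl
        exact Finset.notMem_empty _ (h2 hmd)
      · rintro rfl
        exact hnl l hlm (h2 hmd)
  have h2 : ∑ I ∈ ((hrDouble S).powerset.filter (fun I =>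
      (hrDouble {m} ⊆ I ∨ hrDouble {m} ⊆ hrDouble S \ I) ∧ I ≠ ∅ ∧ I ≠ hrDouble S ∧
      ∀ l ∈ S, l ≠ m → I ≠ hrDouble {l} ∧ I ≠ hrDouble S \ hrDouble {l})).filter
      (fun I => ¬ hrDouble {m} ⊆ I),
        ((1 / 2 : ℂ) * hrSign S I) • (diag (hrDiag S I) : PartAlg ℂ δ r) =
      ∑ I ∈ G, ((1 / 2 : ℂ) * hrSign S I) • diag (hrDiag S I) := by
    have hss : ∀ {I J : Finset (DiagVertex r)}, I ⊆ hrDouble S → hrDouble S \ I = J →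
        I = hrDouble S \ J := by
      rintro I _ hI rfl
      exact (Finset.sdiff_sdiff_eq_self hI).symm
    refine Finset.sum_nbij' (fun I => hrDouble S \ I) (fun I => hrDouble S \ I) ?_ ?_ ?_ ?_ ?_
    · intro I hI
      rw [Finset.mem_filter, Finset.mem_filter, Finset.mem_powerset] at hI
      obtain ⟨⟨h1, h2, h3, h4, h5⟩, h6⟩ := hI
      rw [hmem]
      refine ⟨Finset.sdiff_subset, h2.resolve_left h6, fun h => h3 ?_, fun l hl hlm h => ?_⟩
      · rw [hss h1 h, Finset.sdiff_self]
      · refine (h5 l hl hlm).1 ?_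
        rw [hss h1 h, Finset.sdiff_sdiff_eq_self (hrDouble_singleton_subset_hrDouble hl)]
    · intro I hI
      rw [hmem] at hI
      obtain ⟨h1, h2, h3, h4⟩ := hI
      rw [Finset.mem_filter, Finset.mem_filter, Finset.mem_powerset]
      refine ⟨⟨Finset.sdiff_subset, Or.inr ?_, fun h => h3 ?_, fun h => ?_, fun l hl hlm =>
        ⟨fun h => h4 l hl hlm (hss h1 h), fun h => ?_⟩⟩, fun h => ?_⟩
      · rwa [Finset.sdiff_sdiff_eq_self h1]
      · rw [hss h1 h, Finset.sdiff_empty]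
      · have h5 := h2 hmd
        rw [hss h1 h, Finset.sdiff_self] at h5
        exact Finset.notMem_empty _ h5
      · have h5 := hss h1 h
        rw [Finset.sdiff_sdiff_eq_self (hrDouble_singleton_subset_hrDouble hl)] at h5
        exact hnl l hlm (h5 ▸ h2 hmd)
      · exact (Finset.mem_sdiff.1 (h hmd)).2 (h2 hmd)
    · intro I hI
      exact Finset.sdiff_sdiff_eq_self
        (Finset.mem_powerset.1 (Finset.mem_filter.1 (Finset.mem_filter.1 hI).1).1)
    · intro I hI
      exact Finset.sdiff_sdiff_eq_self ((hmem I).1 hI).1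
    · intro I hI
      rw [hrSign_sdiff
        (Finset.mem_powerset.1 (Finset.mem_filter.1 (Finset.mem_filter.1 hI).1).1), hrDiag_sdiff]
  rw [h1, h2, ← Finset.sum_add_distrib]
  refine Finset.sum_congr rfl fun I _ => ?_
  rw [← add_smul]
  congr 1
  ring

/-- The terms produced by the exceptional index sets in `p̃_S`. -/
noncomputable def excTermHalf (δ : ℂ) (m : Fin r) (T : Finset (Fin r)) : PartAlg ℂ δ r :=
  if m ∈ T then ((-1 : ℂ) ^ (T.card + 1)) • diag (hrBlock T) else 0

/-- The missing sets are the complements of `{l, l'}` with `l ≠ m`, each giving `b_{S \ l}`. The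
summand `l = m` is zero by the definition of `excTermHalf`. -/
theorem fixedP_eq {m : Fin r} {S : Finset (Fin r)} (hm : m ∈ S) (hS : 2 ≤ S.card) :
    fixedP δ m S = hrPTilde δ m S + ∑ l ∈ S, excTermHalf δ m (S.erase l) := by
  rw [hrPTilde_eq hm, fixedP, ← Finset.sum_filter_add_sum_filter_not _ (TildeCond m S)]
  congr 1
  have h1 : ((hrDouble S).powerset.filter
      (fun I => hrDouble {m} ⊆ I ∧ I ≠ hrDouble S)).filter (fun I => ¬ TildeCond m S I) =
      (S.erase m).image fun l => hrDouble S \ hrDouble {l} := by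
    ext I
    rw [Finset.mem_filter, Finset.mem_filter, Finset.mem_powerset, Finset.mem_image]
    simp only [TildeCond, Finset.mem_erase]
    push Not
    constructor
    · rintro ⟨-, l, hl, hlm, rfl⟩
      exact ⟨l, ⟨hlm, hl⟩, rfl⟩
    · rintro ⟨l, ⟨hlm, hl⟩, rfl⟩
      refine ⟨⟨Finset.sdiff_subset, ?_, fun h => ?_⟩, l, hl, hlm, rfl⟩
      · rw [hrDouble_sdiff]
        refine hrDouble_singleton_subset_hrDouble ?_
        simp [hm, hlm.symm]
      · have h2 : Sum.inl l ∈ hrDouble S := mem_hrDouble.2 hl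
        rw [← h, Finset.mem_sdiff, mem_hrDouble (S := {l})] at h2
        exact h2.2 (by simp)
  rw [h1, Finset.sum_image, ← Finset.add_sum_erase _ _ hm, excTermHalf,
    if_neg (Finset.notMem_erase m S), zero_add]
  · refine Finset.sum_congr rfl fun l hl => ?_
    obtain ⟨hlm, hl⟩ := Finset.mem_erase.1 hl
    rw [hrSign_sdiff (hrDouble_singleton_subset_hrDouble hl), hrSign_hrDouble_singleton hl,
      hrDiag_sdiff, hrDiag_hrDouble_singleton hl, excTermHalf,
      if_pos (Finset.mem_erase.2 ⟨hlm.symm, hm⟩), Finset.card_erase_of_mem hl,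
      Nat.sub_add_cancel (by omega)]
  · intro l hl l' hl' h
    have hl := Finset.mem_of_mem_erase (Finset.mem_coe.1 hl)
    have hl' := Finset.mem_of_mem_erase (Finset.mem_coe.1 hl')
    have h1 := congrArg (hrDouble S \ ·) h
    simp only [Finset.sdiff_sdiff_eq_self (hrDouble_singleton_subset_hrDouble hl),
      Finset.sdiff_sdiff_eq_self (hrDouble_singleton_subset_hrDouble hl')] at h1
    exact hrDouble_singleton_injective h1

theorem fixedP_singleton (m : Fin r) : fixedP δ m {m} = 0 := by
  rw [fixedP, Finset.filter_false_of_mem, Finset.sum_empty]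
  intro I hI h
  exact h.2 ((Finset.mem_powerset.1 hI).antisymm h.1)

theorem hrMHalf_eq (k : ℕ) :
    hrMHalf δ k = δ • 1 +
      ∑ S ∈ (Finset.univ : Finset (Fin (k + 1))).powerset.filter (fun S => Fin.last k ∈ S),
        (fixedP δ (Fin.last k) S + (δ * (-1) ^ S.card) • diag (hrBlock S)) := by
  set m := Fin.last k with hmk
  set K := (Finset.univ : Finset (Fin (k + 1))) with hK
  have hsing : ∀ S : Finset (Fin (k + 1)), m ∈ S → ¬ 2 ≤ S.card → S = {m} := fun S hm hS =>
    Finset.eq_singleton_iff_unique_mem.2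
      ⟨hm, fun l hl => Finset.card_le_one.1 (by omega) l hl m hm⟩
  have h1 : ∑ S ∈ K.powerset, (if m ∈ S then fixedP δ m S else 0) =
      ∑ S ∈ K.powerset, (if m ∈ S ∧ 2 ≤ S.card then hrPTilde δ m S else 0) +
      ∑ T ∈ K.powerset, (((k + 1 : ℕ) : ℂ) - T.card) • excTermHalf δ m T := by
    have h3 := sum_powerset_sum_erase K (excTermHalf δ m)
    rw [hK, Finset.card_univ, Fintype.card_fin, ← hK] at h3
    rw [← h3, ← Finset.sum_add_distrib]
    refine Finset.sum_congr rfl fun S _ => ?_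
    by_cases hm : m ∈ S
    · by_cases hS : 2 ≤ S.card
      · rw [if_pos hm, if_pos ⟨hm, hS⟩, fixedP_eq hm hS]
      · rw [if_pos hm, if_neg fun h => hS h.2, hsing S hm hS, fixedP_singleton,
          Finset.sum_singleton, excTermHalf, if_neg (by simp), add_zero]
    · rw [if_neg hm, if_neg fun h => hm h.1, zero_add, Finset.sum_eq_zero]
      intro l _
      rw [excTermHalf, if_neg fun h => hm (Finset.mem_of_mem_erase h)]
  -- The set `{m}` receives `k` exceptional terms from the sets `{m, l}` and `-δ` from its own block
  -- term. With the scalar `δ` this leaves the constant `k` in the definition of `Z_{k+1/2}`.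
  have h2 : ∑ S ∈ K.powerset, (if S = {m} then (k - δ) • (1 : PartAlg ℂ δ (k + 1)) else 0) =
      (k - δ) • 1 := by
    rw [Finset.sum_ite_eq', if_pos (by simp [hK])]
  have h3 : ∑ T ∈ K.powerset, (((k + 1 : ℕ) : ℂ) - T.card) • excTermHalf δ m T +
      ∑ S ∈ K.powerset, (if m ∈ S then (δ * (-1) ^ S.card) • diag (hrBlock S) else 0) =
      ∑ S ∈ K.powerset, (if m ∈ S ∧ 2 ≤ S.card then ((δ - (k + 1) + S.card) * (-1) ^ S.card) •
        (diag (hrBlock S) : PartAlg ℂ δ (k + 1)) else 0) + (k - δ) • 1 := by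
    rw [← h2, ← Finset.sum_add_distrib, ← Finset.sum_add_distrib]
    refine Finset.sum_congr rfl fun S _ => ?_
    rw [excTermHalf]
    by_cases hm : m ∈ S
    · by_cases hS : 2 ≤ S.card
      · rw [if_pos hm, if_pos hm, if_pos ⟨hm, hS⟩, if_neg, smul_smul, ← add_smul, add_zero]
        · congr 1
          push_cast
          ring
        · rintro rfl
          simp at hS
      · have h4 := hsing S hm hS
        have h5 : S.card = 1 := by rw [h4, Finset.card_singleton]
        rw [if_pos hm, if_pos hm, if_neg fun h => hS h.2, if_pos h4, diag_hrBlock_eq_one h5.le, h5,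
          smul_smul, ← add_smul, zero_add]
        congr 1
        push_cast
        ring
    · rw [if_neg hm, if_neg hm, if_neg fun h => hm h.1, if_neg, smul_zero]
      rintro rfl
      simp at hm
  rw [hrMHalf, hrZHalf, Finset.sum_add_distrib, Finset.sum_add_distrib]
  simp only [Finset.sum_filter]
  rw [h1, add_assoc _ _ (∑ S ∈ K.powerset,
    (if m ∈ S then (δ * (-1) ^ S.card) • (diag (hrBlock S) : PartAlg ℂ δ (k + 1)) else 0)), h3,
    sub_smul]
  abel

end collectHalf

/-! ### The action of the elements of Halverson and Ram -/

section action

variable {N r k : ℕ}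

/-- The term `S = ∅` of the expansion contributes `N ^ 2` copies of the identity, half of which must
be subtracted. -/
theorem mat_hrZ (hk : k ≤ r) (x y : Fin r → Fin N) :
    mat N r (hrZ N r k) x y = (k * N - N ^ 2 / 2) * ind (y = x) +
      1 / 2 * ∑ b, ∑ c, ind (y = recolor k b c x) := by
  have h1 : ∑ b, ∑ c, ind (y = recolor k b c x) =
      N ^ 2 * ind (y = x) +
      2 * ∑ S ∈ (Finset.univ.filter fun v : Fin r => (v : ℕ) + 1 ≤ k).powerset.filter
        (fun S => 1 ≤ S.card),
        mat N r (fullP N S + ((N : ℂ) * (-1) ^ S.card) • diag (hrBlock S)) x y := by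
    simp only [recolor_entry]
    have h2 : ∀ b : Fin N, ∑ c, ∑ S ∈ (Finset.univ.filter
        fun v : Fin r => (v : ℕ) + 1 ≤ k).powerset, swapTerm x y S b c =
        ∑ S ∈ (Finset.univ.filter fun v : Fin r => (v : ℕ) + 1 ≤ k).powerset,
          ∑ c, swapTerm x y S b c := fun b => Finset.sum_comm
    simp only [h2]
    rw [Finset.sum_comm, ← Finset.sum_filter_add_sum_filter_not _ (fun S => 1 ≤ S.card), add_comm,
      Finset.mul_sum]
    congr 1
    · rw [Finset.sum_eq_single ∅, sum_swapTerm_empty, mat_one_apply]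
      · intro S hS hne
        exact absurd (Finset.card_eq_zero.1 (by have := (Finset.mem_filter.1 hS).2; omega)) hne
      · simp
    · refine Finset.sum_congr rfl fun S hS => sum_swapTerm_of_nonempty x y ?_
      exact Finset.card_pos.1 (Finset.mem_filter.1 hS).2
  rw [h1, hrZ_eq hk, mat_add_apply, mat_sum_apply, mat_smul_apply, mat_one_apply]
  ring

theorem mat_hrMHalf (x y : Fin (k + 1) → Fin N) :
    mat N (k + 1) (hrMHalf N k) x y =
      N * ind (y = x) - ∑ c, ind (y = recolor k (x (Fin.last k)) c x) := by
  rw [hrMHalf_eq, mat_add_apply, mat_sum_apply, mat_smul_apply, mat_one_apply, sum_recolor_last]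
  ring

theorem act_eq_sum (a : PartAlg ℂ (N : ℂ) r) (f : (Fin r → Fin N) → ℂ) (x : Fin r → Fin N) :
    act a f x = ∑ y, mat N r a x y * f y := rfl

theorem sum_ind_mul (f : (Fin r → Fin N) → ℂ) (z : Fin r → Fin N) :
    ∑ y, ind (y = z) * f y = f z := by
  simp only [eq_comm (b := z)]
  exact sum_ind_eq_mul z f

theorem act_hrMHalf : ActsAsLHalf (Fin.last k) (hrMHalf (N : ℂ) k) := by
  intro f x
  rw [act_eq_sum]
  simp only [mat_hrMHalf, sub_mul, Finset.sum_sub_distrib, mul_assoc, ← Finset.mul_sum,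
    sum_ind_mul, Finset.sum_mul]
  rw [Finset.sum_comm]
  simp only [sum_ind_mul, Fin.val_last]

theorem act_hrZ (hk : k ≤ r) (f : (Fin r → Fin N) → ℂ) (x : Fin r → Fin N) :
    act (hrZ (N : ℂ) r k) f x =
      (k * N - N ^ 2 / 2) * f x + 1 / 2 * ∑ b, ∑ c, f (recolor k b c x) := by
  rw [act_eq_sum]
  simp only [mat_hrZ hk, add_mul, Finset.sum_add_distrib, mul_assoc, ← Finset.mul_sum,
    sum_ind_mul, Finset.sum_mul]
  congr 2
  rw [Finset.sum_comm]
  refine Finset.sum_congr rfl fun b _ => ?_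
  rw [Finset.sum_comm]
  simp only [sum_ind_mul]

theorem recolor_comm {C : Type*} [DecidableEq C] (m : ℕ) (b c : C) (x : Fin r → C) :
    recolor m b c x = recolor m c b x := by
  funext w
  simp only [recolor]
  grind

theorem recolor_self {C : Type*} [DecidableEq C] (m : ℕ) (b : C) (x : Fin r → C) :
    recolor m b b x = x := by
  funext w
  simp only [recolor]
  grind

theorem recolor_succ_last {C : Type*} [DecidableEq C] {b c : C} {x : Fin (k + 1) → C}
    (hb : x (Fin.last k) ≠ b) (hc : x (Fin.last k) ≠ c) :
    recolor (k + 1) b c x = recolor k b c x := by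
  funext w
  by_cases hw : w = Fin.last k
  · subst hw
    simp only [recolor]
    grind
  · have h1 := Fin.val_ne_of_ne hw
    rw [Fin.val_last] at h1
    have h2 := w.isLt
    simp only [recolor]
    rw [if_pos h2, if_pos (show (w : ℕ) < k by omega)]

/-- The summand is symmetric in `b` and `c`, zero on the diagonal, and zero unless one of the
colours is that of the last letter; only one row and the equal column of it remain. -/
theorem sum_recolor_succ (f : (Fin (k + 1) → Fin N) → ℂ) (x : Fin (k + 1) → Fin N) :
    ∑ b, ∑ c, (f (recolor (k + 1) b c x) - f (recolor k b c x)) =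
      2 * ∑ c, (f (recolor (k + 1) (x (Fin.last k)) c x) -
        f (recolor k (x (Fin.last k)) c x)) := by
  set a := x (Fin.last k)
  set g : Fin N → Fin N → ℂ := fun b c => f (recolor (k + 1) b c x) - f (recolor k b c x) with hg
  have hcomm : ∀ b c, g b c = g c b := fun b c => by
    simp only [hg, recolor_comm _ b c]
  have hself : ∀ b, g b b = 0 := fun b => by simp only [hg, recolor_self, sub_self]
  have hz : ∀ b c, a ≠ b → a ≠ c → g b c = 0 := fun b c hb hc => by
    simp only [hg, recolor_succ_last hb hc, sub_self]
  have h1 : ∀ b c, g b c = ind (a = b) * g a c + ind (a = c) * g a b := by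
    intro b c
    by_cases hb : a = b
    · by_cases hc : a = c
      · rw [← hb, ← hc, hself, mul_zero, add_zero]
      · rw [ind_of_true hb, ind_of_false hc, ← hb, one_mul, zero_mul, add_zero]
    · by_cases hc : a = c
      · rw [ind_of_false hb, ind_of_true hc, ← hc, one_mul, zero_mul, zero_add, hcomm]
      · rw [ind_of_false hb, ind_of_false hc, hz b c hb hc, zero_mul, zero_mul, add_zero]
  change ∑ b, ∑ c, g b c = 2 * ∑ c, g a c
  have h2 : ∀ b, ∑ c, g b c = ind (a = b) * ∑ c, g a c + g a b := by
    intro b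
    rw [Finset.sum_congr rfl fun c _ => h1 b c, Finset.sum_add_distrib, ← Finset.mul_sum,
      sum_ind_eq_mul a fun _ => g a b]
  rw [Finset.sum_congr rfl fun b _ => h2 b, Finset.sum_add_distrib, sum_ind_eq_mul a fun _ => ∑ c, g a c]
  ring

/-- In `Z_{k+1} - Z_k` the scalar parts leave `N`, and the transpositions leave the difference of
the recolourings of `k + 1` and of `k` letters. Subtracting `M_{k+1/2}` cancels `N` and the
recolourings of `k` letters. -/
theorem act_hrMSucc : ActsAsL (Fin.last k) (hrMSucc (N : ℂ) k) := by
  intro f x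
  have h : hrMSucc (N : ℂ) k = hrZ N (k + 1) (k + 1) - hrZ N (k + 1) k - hrMHalf N k := by
    rw [hrMSucc, hrMHalf]
    abel
  have h1 := sum_recolor_succ f x
  simp only [Finset.sum_sub_distrib] at h1
  rw [h, act_sub, act_sub, act_hrZ le_rfl, act_hrZ (Nat.le_succ k), act_hrMHalf f x, Fin.val_last]
  push_cast
  linear_combination 1 / 2 * h1

end action

end PartAlg

theorem mainTheorem2 (n : ℕ) (hn : 1 ≤ n) (k : ℕ) (hk : 1 ≤ k) :
    PartAlg.hrMHalf (n : ℂ) k = PartAlg.jmLHalf ℂ (n : ℂ) (k + 1) k ∧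
    PartAlg.hrMSucc (n : ℂ) k = PartAlg.jmL ℂ (n : ℂ) (k + 1) (k + 1) := by
  constructor
  -- The bound `2 * (k + 1)` is the number of colours that makes the action on words of length `k +
  -- 1` faithful.
  · refine PartAlg.IsPolyFamily.ext
      ((PartAlg.IsPolyFamily.hrZHalf k).sub (PartAlg.IsPolyFamily.hrZ k))
      (PartAlg.IsPolyFamily.jmLHalf k) (2 * (k + 1)) (fun N hN => ?_) n
    refine PartAlg.eq_of_act hN fun f x => ?_
    exact (PartAlg.act_hrMHalf f x).trans (PartAlg.act_jmLHalf k (Fin.last k) rfl f x).symm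
  · refine PartAlg.IsPolyFamily.ext
      ((PartAlg.IsPolyFamily.hrZ (k + 1)).sub (PartAlg.IsPolyFamily.hrZHalf k))
      (PartAlg.IsPolyFamily.jmL (k + 1)) (2 * (k + 1)) (fun N hN => ?_) n
    refine PartAlg.eq_of_act hN fun f x => ?_
    exact (PartAlg.act_hrMSucc f x).trans (PartAlg.act_jmL (Fin.last k) f x).symm
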